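/- An instance $(G,Z_1,\dots,Z_k)$ of Disjoint Connected Subgraphs consists of a finite simple graph $G$, an integer $k\ge 0$ and pairwise disjoint sets $Z_1,\dots,Z_k\subseteq V(G)$ (the terminal sets, possibly empty); it is a yes-instance if $G$ has pairwise disjoint vertex sets $S_1,\dots,S_k$ such that, for every $i\in\{1,\dots,k\}$, the set $S_i$ induces a connected (in particular non-empty) subgraph of $G$ and $Z_i\subseteq S_i$. The number $k$ is part of the input. Instances are encoded as strings over the alphabet $\{0,1,\#\}$ by the adjacency matrix of $G$ followed by the characteristic vectors of $Z_1,\dots,Z_k$. Lemma. Disjoint Connected Subgraphs is polynomial-time solvable for $P_4$-free graphs (cographs): there are a (deterministic, multi-stack) Turing machine $M$ and a polynomial $p$ such that, for every instance $I=(G,Z_1,\dots,Z_k)$ in which $G$ has no induced path on four vertices, $M$ started on the encoding of $I$ halts after at most $p(\ell)$ steps, where $\ell$ is the length of this encoding, and outputs whether or not $I$ is a yes-instance. -/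

import Mathlib

/-- `S` is a solution of the instance `(G, Z_1, …, Z_k)` of Disjoint Connected Subgraphs:
the sets `S i` are pairwise disjoint, each of them is connected in `G` (that is, it induces a
connected, in particular non-empty, subgraph), and `S i` contains the terminal set `Z i`. -/
def IsDCSSolution {V : Type*} (G : SimpleGraph V) {k : ℕ} (Z S : Fin k → Set V) : Prop :=
  (∀ i j, i ≠ j → Disjoint (S i) (S j)) ∧
    (∀ i, (G.induce (S i)).Connected) ∧
    ∀ i, Z i ⊆ S i

/-- An instance of Disjoint Connected Subgraphs: a finite graph (with vertices numbered
`0, …, n - 1`) and `k` pairwise disjoint terminal sets. The number `k` is part of the input. -/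
structure DCSInstance where
  /-- number of vertices -/
  n : ℕ
  /-- the graph -/
  G : SimpleGraph (Fin n)
  /-- number of terminal sets -/
  k : ℕ
  /-- the terminal sets -/
  Z : Fin k → Set (Fin n)
  /-- the terminal sets are pairwise disjoint -/
  disjoint : ∀ i j, i ≠ j → Disjoint (Z i) (Z j)

namespace DCSInstance

/-- Yes-instances: `G` has pairwise disjoint connected sets `S_1, …, S_k` with `Z_i ⊆ S_i`. -/
def IsYes (I : DCSInstance) : Prop :=
  ∃ S : Fin I.k → Set (Fin I.n), IsDCSSolution I.G I.Z S

/-- The graph of the instance is `P_4`-free: it has no induced path on four vertices. -/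
def IsP4Free (I : DCSInstance) : Prop :=
  ¬ (SimpleGraph.pathGraph 4).IsIndContained I.G

open Classical in
/-- The row of bits `p 0, …, p (n - 1)`, closed by the separator `none`. -/
noncomputable def encodeRow {n : ℕ} (p : Fin n → Prop) : List (Option Bool) :=
  List.ofFn (fun v => some (decide (p v))) ++ [none]

/-- The input string of an instance, over the three-letter alphabet `{0, 1, separator}`:
the rows of the adjacency matrix of `G`, one more separator, and the characteristic
vectors of `Z_1, …, Z_k`. -/
noncomputable def encode (I : DCSInstance) : List (Option Bool) :=
  (List.ofFn fun u => encodeRow (fun v => I.G.Adj u v)).flatten ++ [none] ++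
    (List.ofFn fun i => encodeRow (fun v => v ∈ I.Z i)).flatten

end DCSInstance

open Classical in
/-- The decision problem `yes`, with inputs written as strings by `enc`, is solvable in polynomial
time on the class `C` of inputs: there are a multi-stack Turing machine and a polynomial `p`
such that on every input `a` in `C` the machine halts within `p (length of enc a)` steps,
and outputs `true` if `a` is a yes-instance and `false` otherwise. -/
def PolyTimeSolvableOn {α Γ : Type} (enc : α → List Γ) (yes C : α → Prop) : Prop :=
  Nonempty (Turing.TM2ComputableInPolyTime (fun a : {a : α // C a} => enc a.1)
    Computability.encodeBool (fun a : {a : α // C a} => decide (yes a.1)))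

/-! A terminal set that is already connected needs no further vertex. In a $P_4$-free graph a
disconnected subset `Z` of a connected set `S` is dominated by one vertex of `S` outside `Z`
(`SimpleGraph.exists_complete_vertex`): for nonempty `Z`, take, among the vertices of `S` with
neighbours in two components of `Z`, one with the most neighbours in `Z`. Conversely, adding a
dominating vertex makes `Z` connected. So the problem is bipartite matching: assign distinct free
dominating vertices to the disconnected terminal sets (`DCSInstance.isYes_iff`).

The matching is decided by an auction. In each round the first unserved bidder buys its cheapest
candidate, provided the price is at most `n`, and that price rises by one. If a full matching exists
and somebody is unserved, a purchase takes place (`Auction.Inv.exists_buys`). Otherwise all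
candidates of the active bidder cost `n + 1`, some price level `t` between `1` and `n` is empty, and
the owners of the items above `t`, together with the active bidder, would all be matched into those
items, one too few. The prices sum to at most `n * (n + 1)`, so more than that many rounds settle
the question (`Auction.served_iff`). The input is longer than this, hence one round per input letter
is enough.

For the machine, the store has one cell per input letter, holding position, letter, price and owner;
a position also serves as the number of a vertex or of a terminal set. One round and the final test
are fixed expressions with sums over the cells. Connectivity can be written this way because
connected $P_4$-free graphs have diameter at most two (`SimpleGraph.connected_induce_iff_near`). All
numbers stay below the input length plus two, so a fixed expression is evaluated in polynomial time
even in unary (`StackProgram.Expr.runs_compile`). The evaluating while programs become `TM2`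
machines with the same step count (`iterate_step_of_run`), and `polyTimeSolvableOn_of_updateStore`
combines these facts. -/

/-! ### A while language over stacks and its compilation to `TM2` machines -/

namespace StackProgram

/-- The stacks of the machine: input, environment, values, loop control, store, auxiliary stack,
new store. -/
inductive Stk
  | I | E | V | C | M | T | N
  deriving DecidableEq

instance : Fintype Stk := ⟨{.I, .E, .V, .C, .M, .T, .N}, fun x => by cases x <;> decide⟩

/-- The stack alphabet. -/
abbrev Sym := Option Bool

/-- Contents of the stacks. -/
abbrev State := Stk → List Sym

/-- Programs of the while language. Tests look at the top symbol of a stack. -/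
inductive Cmd
  | skip
  | push (k : Stk) (a : Sym)
  | mv (k : Stk) (l : List Stk)
  | seq (c d : Cmd)
  | ite (k : Stk) (p : Option Sym → Bool) (c d : Cmd)
  | loop (k : Stk) (p : Option Sym → Bool) (c : Cmd)

namespace Cmd

/-- The state after popping the top symbol `a` of `k` and pushing it on all stacks in `l`. -/
def moved (s : State) (k : Stk) (l : List Stk) (a : Sym) (r : List Sym) : State :=
  fun j => if j = k then r else if j ∈ l then a :: s j else s j

/-- Big-step semantics: `Run c s t n` says that `c` leads from `s` to `t` in exactly `n` steps. -/
inductive Run : Cmd → State → State → ℕ → Prop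
  | skip (s) : Run skip s s 1
  | push (k a s) : Run (push k a) s (Function.update s k (a :: s k)) 1
  | mv (k l s a r) (hl : l.Nodup) (hk : k ∉ l) (h : s k = a :: r) :
      Run (mv k l) s (moved s k l a r) 1
  | seq {c d s t u m n} : Run c s t m → Run d t u n → Run (seq c d) s u (m + n)
  | ite_true {k p c d s t n} : p (s k).head? = true → Run c s t n → Run (ite k p c d) s t (n + 1)
  | ite_false {k p c d s t n} : p (s k).head? = false → Run d s t n → Run (ite k p c d) s t (n + 1)
  | loop_done {k p c s} : p (s k).head? = false → Run (loop k p c) s s 1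
  | loop_step {k p c s t u m n} : p (s k).head? = true → Run c s t m → Run (loop k p c) t u n →
      Run (loop k p c) s u (m + n + 1)

/-! ### Compilation of while programs to machines -/

/-- Labels of the compiled program. -/
def Lab : Cmd → Type
  | skip => Unit
  | push _ _ => Unit
  | mv _ _ => Unit
  | seq c d => Lab c ⊕ Lab d
  | ite _ _ c d => Option (Lab c ⊕ Lab d)
  | loop _ _ c => Option (Lab c)

/-- There are finitely many labels. -/
@[reducible] def fintypeLab : (c : Cmd) → Fintype (Lab c)
  | skip => inferInstanceAs (Fintype Unit)
  | push _ _ => inferInstanceAs (Fintype Unit)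
  | mv _ _ => inferInstanceAs (Fintype Unit)
  | seq c d => by
      haveI := fintypeLab c
      haveI := fintypeLab d
      exact inferInstanceAs (Fintype (Lab c ⊕ Lab d))
  | ite _ _ c d => by
      haveI := fintypeLab c
      haveI := fintypeLab d
      exact inferInstanceAs (Fintype (Option (Lab c ⊕ Lab d)))
  | loop _ _ c => by
      haveI := fintypeLab c
      exact inferInstanceAs (Fintype (Option (Lab c)))

/-- The entry label. -/
def entry : (c : Cmd) → Lab c
  | skip => ()
  | push _ _ => ()
  | mv _ _ => ()
  | seq c _ => Sum.inl (entry c)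
  | ite _ _ _ _ => none
  | loop _ _ _ => none

/-- The alphabets of the stacks of the machine: `none` is the output stack. -/
@[reducible] def Alph : Option Stk → Type
  | none => Bool
  | some _ => Sym

/-- Statements of the machine. -/
abbrev MStmt (L : Type) := Turing.TM2.Stmt Alph L (Option Sym)

/-- Push the symbol in the internal state on all stacks in `l`. -/
def pushAll {L : Type} (q : MStmt L) : List Stk → MStmt L
  | [] => q
  -- The default is never used in a run, since `Run.mv` only applies to a nonempty stack.
  | k :: l => .push (some k) (fun v => (v.getD none : Sym)) (pushAll q l)

/-- Jump to a label with clean internal state. -/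
def jump {L : Type} (l : L) : MStmt L := .load (fun _ => none) (.goto fun _ => l)

/-- The code of a program, with labels embedded in `L` by `emb` and exit label `exit`. -/
def code {L : Type} : (c : Cmd) → (Lab c → L) → L → Lab c → MStmt L
  | skip, _, ex, _ => jump ex
  | push k a, _, ex, _ => .push (some k) (fun _ => (a : Sym)) (jump ex)
  | mv k l, _, ex, _ => .pop (some k) (fun _ t => t) (pushAll (jump ex) l)
  | seq c d, emb, ex, l =>
      match l with
      | Sum.inl l => code c (fun x => emb (Sum.inl x)) (emb (Sum.inr (entry d))) l
      | Sum.inr l => code d (fun x => emb (Sum.inr x)) ex l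
  | ite k p c d, emb, ex, l =>
      match l with
      | none => .peek (some k) (fun _ t => t)
          (.branch p (jump (emb (some (Sum.inl (entry c))))) (jump (emb (some (Sum.inr (entry d))))))
      | some (Sum.inl l) => code c (fun x => emb (some (Sum.inl x))) ex l
      | some (Sum.inr l) => code d (fun x => emb (some (Sum.inr x))) ex l
  | loop k p c, emb, ex, l =>
      match l with
      | none => .peek (some k) (fun _ t => t)
          (.branch p (jump (emb (some (entry c)))) (jump ex))
      | some l => code c (fun x => emb (some x)) (emb none) l

/-- The stacks of the machine when its output stack is empty. -/
def liftS (s : State) : ∀ k : Option Stk, List (Alph k)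
  | none => ([] : List Bool)
  | some k => (s k : List Sym)

theorem update_liftS (s : State) (k : Stk) (x : List Sym) :
    Function.update (liftS s) (some k) (x : List (Alph (some k))) =
      liftS (Function.update s k x) := by
  funext j
  cases j with
  | none => rfl
  | some j =>
    by_cases h : j = k
    · subst h
      exact (Function.update_self ..).trans (Function.update_self (β := fun _ => List Sym) ..).symm
    · refine (Function.update_of_ne (by simpa using h) ..).trans ?_
      exact (Function.update_of_ne (β := fun _ => List Sym) h ..).symm

theorem stepAux_pushAll {L : Type} (q : MStmt L) (a : Sym) (l : List Stk) (hl : l.Nodup)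
    (s : State) :
    Turing.TM2.stepAux (pushAll q l) (some a) (liftS s) =
      Turing.TM2.stepAux q (some a) (liftS fun j => if j ∈ l then a :: s j else s j) := by
  induction l generalizing s with
  | nil => simp [pushAll]
  | cons k l ih =>
    rw [List.nodup_cons] at hl
    simp only [pushAll, Turing.TM2.stepAux]
    have := update_liftS s k (a :: s k)
    simp only [liftS, Option.getD_some] at this ⊢
    erw [this, ih hl.2]
    congr 2
    funext j
    by_cases h : j = k
    · subst h; simp [hl.1]
    · simp [h]

/-- The configuration of the machine at a label. -/
def cfg {L : Type} (l : L) (s : State) : Turing.TM2.Cfg Alph L (Option Sym) :=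
  ⟨some l, none, liftS s⟩

theorem stepAux_jump {L : Type} (l : L) (v : Option Sym) (s : State) :
    Turing.TM2.stepAux (jump l) v (liftS s) = cfg l s := rfl

theorem stepAux_test {L : Type} (k : Stk) (p : Option Sym → Bool) (a b : L) (s : State) :
    Turing.TM2.stepAux (.peek (some k) (fun _ t => t) (.branch p (jump a) (jump b)) : MStmt L) none
      (liftS s) = cfg (if p (s k).head? then a else b) s := by
  change cond (p (s k).head?) (cfg a s) (cfg b s) = _
  cases p (s k).head? <;> rfl

theorem stepAux_mv {L : Type} (k : Stk) (l : List Stk) (hl : l.Nodup) (hk : k ∉ l) (e : L)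
    (s : State) (a : Sym) (r : List Sym) (h : s k = a :: r) :
    Turing.TM2.stepAux (.pop (some k) (fun _ t => t) (pushAll (jump e) l) : MStmt L) none
      (liftS s) = cfg e (moved s k l a r) := by
  change Turing.TM2.stepAux (pushAll (jump e) l) (s k).head?
    (Function.update (liftS s) (some k) (s k).tail) = _
  rw [h, List.head?_cons, List.tail_cons]
  refine (congrArg _ (update_liftS s k r)).trans ?_
  rw [stepAux_pushAll _ a l hl, stepAux_jump]
  congr 1
  funext j
  by_cases hj : j = k
  · subst hj; simp [moved, hk]
  · simp [moved, hj]

/-- Each elementary command and each test is one machine step, so the step counts agree exactly. The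
embedding and the exit label are arbitrary because the induction places subprograms inside larger
ones: the first part of a sequence exits to the second, a loop body exits to the loop's own test. -/
theorem iterate_step_of_run {L : Type} (M : L → MStmt L) {c : Cmd} {s t : State} {n : ℕ}
    (h : Run c s t n) :
    ∀ (emb : Lab c → L) (ex : L), (∀ l, M (emb l) = code c emb ex l) →
      (flip bind (Turing.TM2.step M))^[n] (some (cfg (emb (entry c)) s)) = some (cfg ex t) := by
  have one : ∀ (l : L) (s : State), flip bind (Turing.TM2.step M) (some (cfg l s)) =
      some (Turing.TM2.stepAux (M l) none (liftS s)) := fun l s => rfl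
  induction h with
  | skip s =>
    intro emb ex hM
    rw [Function.iterate_one, one, hM]
    rfl
  | push k a s =>
    intro emb ex hM
    rw [Function.iterate_one, one, hM]
    simp only [code, Turing.TM2.stepAux]
    erw [update_liftS s k (a :: s k)]
    rfl
  | mv k l s a r hl hk h =>
    intro emb ex hM
    rw [Function.iterate_one, one, hM]
    exact congrArg some (stepAux_mv k l hl hk ex s a r h)
  | @seq c d s t u m n _ _ ih1 ih2 =>
    intro emb ex hM
    -- An iterate of a sum applies the second summand first, so the steps of `c` must come second.
    rw [Nat.add_comm, Function.iterate_add_apply]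
    have h1 := ih1 (fun x => emb (Sum.inl x)) (emb (Sum.inr (entry d))) (fun l => hM (Sum.inl l))
    have h2 := ih2 (fun x => emb (Sum.inr x)) ex (fun l => hM (Sum.inr l))
    exact (congrArg _ h1).trans h2
  | @ite_true k p c d s t n hp _ ih =>
    intro emb ex hM
    have h1 := ih (fun x => emb (some (Sum.inl x))) ex (fun l => hM (some (Sum.inl l)))
    rw [Function.iterate_succ_apply, one, hM]
    refine (congrArg _ (congrArg some ((stepAux_test ..).trans ?_))).trans h1
    rw [if_pos hp]
  | @ite_false k p c d s t n hp _ ih =>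
    intro emb ex hM
    have h1 := ih (fun x => emb (some (Sum.inr x))) ex (fun l => hM (some (Sum.inr l)))
    rw [Function.iterate_succ_apply, one, hM]
    refine (congrArg _ (congrArg some ((stepAux_test ..).trans ?_))).trans h1
    rw [if_neg (by simp [hp])]
  | @loop_done k p c s hp =>
    intro emb ex hM
    rw [Function.iterate_one, one, hM]
    refine congrArg some ((stepAux_test ..).trans ?_)
    rw [if_neg (by simp [hp])]
  | @loop_step k p c s t u m n hp _ _ ih1 ih2 =>
    intro emb ex hM
    have h1 := ih1 (fun x => emb (some x)) (emb none) (fun l => hM (some l))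
    have h2 := ih2 emb ex hM
    rw [Function.iterate_succ_apply, one, hM, Nat.add_comm, Function.iterate_add_apply]
    refine (congrArg _ (Eq.trans ?_ h1)).trans h2
    refine congrArg _ (congrArg some ((stepAux_test ..).trans ?_))
    rw [if_pos hp]

/-- The final statement: move the verdict from the value stack to the output stack. -/
def finish {L : Type} : MStmt L :=
  .pop (some .V) (fun _ t => t)
    (.push none (fun v => (decide (v = some (some true)) : Bool)) (.load (fun _ => none) .halt))

/-- The machine that runs `c` and then reports the top symbol of the value stack. -/
def machine (c : Cmd) : Turing.FinTM2 where
  K := Option Stk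
  k₀ := some .I
  k₁ := none
  Γ := Alph
  Λ := Option (Lab c)
  main := some (entry c)
  ΛFin := by
    haveI := fintypeLab c
    infer_instance
  σ := Option Sym
  initialState := none
  Γk₀Fin := inferInstanceAs (Fintype Sym)
  m := fun l => match l with
    | none => finish
    | some l => code c some none l

/-- The state with the string `w` on the input stack, all other stacks being empty. -/
def inputState (w : List Sym) : State := fun k => if k = .I then w else []

/-- The state with `w` on the value stack, all other stacks being empty. -/
def valueState (w : List Sym) : State := fun k => if k = .V then w else []

/-- The additional step is `finish`. A halting configuration has only the output stack filled, which
is why the program must end with everything but the verdict erased. -/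
theorem iterate_step_machine {c : Cmd} {w : List Sym} {b : Bool} {n : ℕ}
    (h : Run c (inputState w) (valueState [some b]) n) :
    (flip bind (machine c).step)^[n + 1]
      (some (Turing.initList (machine c) w)) =
      some (Turing.haltList (machine c) ([b] : List Bool)) := by
  have h1 := iterate_step_of_run (machine c).m h some none (fun l => rfl)
  have h0 : Turing.initList (machine c) w = cfg (some (entry c)) (inputState w) := by
    unfold Turing.initList cfg
    congr 1
    funext k
    cases k with
    | none => rfl
    | some k => cases k <;> rfl
  rw [Nat.add_comm, Function.iterate_add_apply, h0, Function.iterate_one]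
  refine (congrArg _ h1).trans ?_
  change some (Turing.TM2.stepAux finish none (liftS (valueState [some b]))) = _
  congr 1
  simp only [finish, Turing.TM2.stepAux]
  unfold Turing.haltList
  congr 1
  funext k
  cases k with
  | none => cases b <;> rfl
  | some k => cases k <;> rfl

/-- A problem is solvable in polynomial time if a program of the while language solves it in
polynomially many steps. -/
theorem polyTimeSolvableOn_of_run {α : Type} (enc : α → List Sym) (yes C : α → Prop) (c : Cmd)
    (p : Polynomial ℕ)
    (h : ∀ a, C a → ∃ b : Bool, (b = true ↔ yes a) ∧ ∃ n ≤ p.eval (enc a).length,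
      Run c (inputState (enc a)) (valueState [some b]) n) :
    PolyTimeSolvableOn enc yes C := by
  classical
  refine ⟨{ tm := machine c, inputAlphabet := Equiv.refl _, outputAlphabet := Equiv.refl _,
            time := p + 1, outputsFun := fun a => ?_ }⟩
  have h1 := h a.1 a.2
  -- The goal is data, so the run is extracted by choice.
  choose b hb n hn hr using h1
  refine { steps := n + 1, evals_in_steps := ?_, steps_le_m := ?_ }
  · have h2 := iterate_step_machine hr
    have hb' : decide (yes a.1) = b := by
      cases b <;> simp_all
    simp only [Computability.encodeBool, Option.map_some]
    have e : (List.map (Equiv.refl Bool).invFun [decide (yes a.1)]) = [b] := by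
      rw [hb']; rfl
    have e2 : (List.map (Equiv.refl Sym).invFun (enc a.1)) = enc a.1 := by
      simp
    refine Eq.trans ?_ (h2.trans ?_)
    · exact congrArg _ (congrArg some (congrArg _ e2))
    · exact congrArg some (congrArg _ e.symm)
  · simpa using hn

end Cmd

end StackProgram

namespace StackProgram

namespace Cmd

/-! ### Time-bounded runs -/

/-- `c` leads from `s` to `t` in at most `B` steps. -/
def Runs (c : Cmd) (s t : State) (B : ℕ) : Prop := ∃ n ≤ B, Run c s t n

theorem Runs.mono {c : Cmd} {s t : State} {B B' : ℕ} (h : Runs c s t B) (hB : B ≤ B') :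
    Runs c s t B' := by
  obtain ⟨n, hn, h⟩ := h
  exact ⟨n, hn.trans hB, h⟩

theorem Runs.seq {c d : Cmd} {s t u : State} {A B : ℕ} (h : Runs c s t A) (h' : Runs d t u B) :
    Runs (seq c d) s u (A + B) := by
  obtain ⟨m, hm, h⟩ := h
  obtain ⟨n, hn, h'⟩ := h'
  exact ⟨m + n, add_le_add hm hn, .seq h h'⟩

theorem runs_skip (s : State) : Runs skip s s 1 := ⟨1, le_rfl, .skip s⟩

theorem runs_push {k : Stk} {a : Sym} {s t : State} (h : t = Function.update s k (a :: s k)) :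
    Runs (push k a) s t 1 := h ▸ ⟨1, le_rfl, .push k a s⟩

theorem runs_mv {k : Stk} {l : List Stk} {s t : State} (a : Sym) (r : List Sym)
    (hl : l.Nodup) (hk : k ∉ l) (h : s k = a :: r) (ht : t = moved s k l a r) :
    Runs (mv k l) s t 1 := ht ▸ ⟨1, le_rfl, .mv k l s a r hl hk h⟩

theorem Runs.ite_true {k : Stk} {p : Option Sym → Bool} {c d : Cmd} {s t : State} {B : ℕ}
    (hp : p (s k).head? = true) (h : Runs c s t B) : Runs (ite k p c d) s t (B + 1) := by
  obtain ⟨n, hn, h⟩ := h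
  exact ⟨n + 1, by omega, .ite_true hp h⟩

theorem Runs.ite_false {k : Stk} {p : Option Sym → Bool} {c d : Cmd} {s t : State} {B : ℕ}
    (hp : p (s k).head? = false) (h : Runs d s t B) : Runs (ite k p c d) s t (B + 1) := by
  obtain ⟨n, hn, h⟩ := h
  exact ⟨n + 1, by omega, .ite_false hp h⟩

/-- A loop whose states are indexed by the processed and the remaining part of a list. -/
theorem runs_loop_list {α : Type} {k : Stk} {p : Option Sym → Bool} {c : Cmd} {B : ℕ}
    (P : List α → List α → State) (l : List α)
    (hbody : ∀ x a y, x ++ a :: y = l → Runs c (P x (a :: y)) (P (x ++ [a]) y) B)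
    (htrue : ∀ x a y, p (P x (a :: y) k).head? = true) (hfalse : ∀ x, p (P x [] k).head? = false) :
    Runs (loop k p c) (P [] l) (P l []) (l.length * (B + 1) + 1) := by
  suffices ∀ x y, x ++ y = l →
      Runs (loop k p c) (P x y) (P l []) (y.length * (B + 1) + 1) from this [] l rfl
  intro x y
  induction y generalizing x with
  | nil =>
    intro h
    rw [List.append_nil] at h
    subst h
    exact ⟨1, by simp, .loop_done (hfalse x)⟩
  | cons a y ih =>
    intro h
    obtain ⟨m, hm, h1⟩ := hbody x a y h
    obtain ⟨n, hn, h2⟩ := ih (x ++ [a]) (by simpa using h)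
    refine ⟨m + n + 1, ?_, .loop_step (htrue x a y) h1 h2⟩
    rw [List.length_cons, Nat.succ_mul]
    omega

/-- The state after pouring `xs` from `k` on the stacks in `l`, where `r` is left on `k`. -/
def poured (s : State) (k : Stk) (l : List Stk) (xs r : List Sym) : State :=
  fun j => if j = k then r else if j ∈ l then xs.reverse ++ s j else s j

/-- The intermediate states are indexed by the part of `xs` already poured. Pouring reverses, so an
order-preserving move takes two pours. -/
theorem runs_pour {k : Stk} {l : List Stk} {p : Option Sym → Bool} {s t : State}
    (xs r : List Sym) (hl : l.Nodup) (hk : k ∉ l) (hs : s k = xs ++ r)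
    (hx : ∀ x ∈ xs, p (some x) = true) (hr : p r.head? = false) (ht : t = poured s k l xs r) :
    Runs (loop k p (mv k l)) s t (2 * xs.length + 1) := by
  subst ht
  have h0 : poured s k l [] (xs ++ r) = s := by
    funext j
    by_cases hj : j = k
    · subst hj; simp [poured, hs]
    · simp [poured, hj]
  suffices ∀ x y, x ++ y = xs → Runs (loop k p (mv k l)) (poured s k l x (y ++ r))
      (poured s k l xs r) (2 * y.length + 1) by
    simpa [h0] using this [] xs rfl
  intro x y
  induction y generalizing x with
  | nil =>
    intro h
    rw [List.append_nil] at h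
    subst h
    exact ⟨1, by simp, .loop_done (by simpa [poured] using hr)⟩
  | cons a y ih =>
    intro h
    obtain ⟨n, hn, h2⟩ := ih (x ++ [a]) (by simpa using h)
    refine ⟨1 + n + 1, by rw [List.length_cons]; omega, .loop_step ?_
      (.mv k l _ a (y ++ r) hl hk (by simp [poured])) ?_⟩
    · have : a ∈ xs := by rw [← h]; simp
      simpa [poured] using hx a this
    · convert h2 using 1
      funext j
      by_cases hj : j = k
      · subst hj; simp [moved, poured]
      · by_cases hm : j ∈ l <;> simp [moved, poured, hj, hm]

/-! ### Numbers on stacks -/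

/-- The symbol for one unit. -/
abbrev tick : Sym := some true

/-- The symbol that ends a number. -/
abbrev sep : Sym := some false

/-- The symbol that ends a block of numbers. -/
abbrev mark : Sym := none

/-- The unary code of a number. -/
def enc (a : ℕ) : List Sym := List.replicate a tick ++ [sep]

/-- The code of a list of numbers. -/
def encs (l : List ℕ) : List Sym := l.flatMap enc

@[simp] theorem length_enc (a : ℕ) : (enc a).length = a + 1 := by simp [enc]

@[simp] theorem encs_nil : encs [] = [] := rfl

@[simp] theorem encs_cons (a : ℕ) (l : List ℕ) : encs (a :: l) = enc a ++ encs l := rfl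

@[simp] theorem encs_append (l l' : List ℕ) : encs (l ++ l') = encs l ++ encs l' := by
  simp [encs]

theorem length_encs_le {b : ℕ} (l : List ℕ) (h : ∀ a ∈ l, a ≤ b) :
    (encs l).length ≤ l.length * (b + 1) := by
  induction l with
  | nil => simp
  | cons a l ih =>
    have h1 := h a (by simp)
    have h2 := ih fun x hx => h x (by simp [hx])
    simp only [encs_cons, List.length_append, length_enc, List.length_cons, Nat.succ_mul]
    omega

/-- Test for a unit. -/
def isTick (o : Option Sym) : Bool := o == some tick

/-- Test for a symbol other than the end mark. -/
def notMark (o : Option Sym) : Bool := o != some mark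

@[simp] theorem isTick_tick : isTick (some (some true)) = true := rfl
@[simp] theorem isTick_sep : isTick (some (some false)) = false := rfl

/-- A state given by its stacks. -/
def mk (i e v c m t n : List Sym) : State
  | .I => i | .E => e | .V => v | .C => c | .M => m | .T => t | .N => n

section mk
variable (i e v c m t n : List Sym)
@[simp] theorem mk_I : mk i e v c m t n .I = i := rfl
@[simp] theorem mk_E : mk i e v c m t n .E = e := rfl
@[simp] theorem mk_V : mk i e v c m t n .V = v := rfl
@[simp] theorem mk_C : mk i e v c m t n .C = c := rfl
@[simp] theorem mk_M : mk i e v c m t n .M = m := rfl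
@[simp] theorem mk_T : mk i e v c m t n .T = t := rfl
@[simp] theorem mk_N : mk i e v c m t n .N = n := rfl
end mk

/-- Move the units on top of `k` to the stacks in `l`. -/
def ticks (k : Stk) (l : List Stk) : Cmd := loop k isTick (mv k l)

/-- Move everything on `k` to the stacks in `l`. -/
def pourAll (k : Stk) (l : List Stk) : Cmd := loop k Option.isSome (mv k l)

theorem runs_ticks {k : Stk} {l : List Stk} {s t : State} (a : ℕ) (r : List Sym)
    (hl : l.Nodup) (hk : k ∉ l) (hs : s k = List.replicate a tick ++ r)
    (hr : isTick r.head? = false) (ht : t = poured s k l (List.replicate a tick) r) :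
    Runs (ticks k l) s t (2 * a + 1) := by
  have := runs_pour (List.replicate a tick) r hl hk hs
    (by simp only [List.mem_replicate]; rintro x ⟨-, rfl⟩; rfl) hr ht
  rwa [List.length_replicate] at this

theorem runs_pourAll {k : Stk} {l : List Stk} {s t : State}
    (hl : l.Nodup) (hk : k ∉ l) (ht : t = poured s k l (s k) []) :
    Runs (pourAll k l) s t (2 * (s k).length + 1) :=
  runs_pour (s k) [] hl hk (by simp) (by simp) rfl ht

/-- Move the number on top of `k` to `k'`. -/
def moveNum (k k' : Stk) : Cmd := seq (ticks k [.T]) (seq (mv k [k']) (pourAll .T [k']))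

theorem runs_moveNum_C_E (i e v c m n : List Sym) (a : ℕ) :
    Runs (moveNum .C .E) (mk i e v (enc a ++ c) m [] n) (mk i (enc a ++ e) v c m [] n)
      (4 * a + 3) := by
  have h1 : Runs (ticks .C [.T]) (mk i e v (enc a ++ c) m [] n)
      (mk i e v (sep :: c) m (List.replicate a tick) n) (2 * a + 1) :=
    runs_ticks a (sep :: c) (by simp) (by simp) (by simp [enc]) rfl
      (by funext j; cases j <;> simp [poured])
  have h2 : Runs (mv .C [.E]) (mk i e v (sep :: c) m (List.replicate a tick) n)
      (mk i (sep :: e) v c m (List.replicate a tick) n) 1 :=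
    runs_mv sep c (by simp) (by simp) rfl (by funext j; cases j <;> simp [moved])
  have h3 : Runs (pourAll .T [.E]) (mk i (sep :: e) v c m (List.replicate a tick) n)
      (mk i (enc a ++ e) v c m [] n) (2 * a + 1) := by
    have := runs_pourAll (k := .T) (l := [.E]) (s := mk i (sep :: e) v c m
      (List.replicate a tick) n) (t := mk i (enc a ++ e) v c m [] n) (by simp) (by simp)
      (by funext j; cases j <;> simp [poured, enc])
    simpa using this
  exact (h1.seq (h2.seq h3)).mono (by omega)

/-- Remove the number on top of `k`. -/
def dropNum (k : Stk) : Cmd := seq (ticks k []) (mv k [])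

theorem runs_dropNum {k : Stk} {s t : State} (a : ℕ) (r : List Sym) (hs : s k = enc a ++ r)
    (ht : t = Function.update s k r) : Runs (dropNum k) s t (2 * a + 2) := by
  subst ht
  have h1 : Runs (ticks k []) s (Function.update s k (sep :: r)) (2 * a + 1) :=
    runs_ticks a (sep :: r) (by simp) (by simp) (by simp [hs, enc]) rfl
      (by funext j; by_cases hj : j = k <;> simp [poured, hj])
  have h2 : Runs (mv k []) (Function.update s k (sep :: r)) (Function.update s k r) 1 :=
    runs_mv sep r (by simp) (by simp) (by simp)
      (by funext j; by_cases hj : j = k <;> simp [moved, hj])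
  exact h1.seq h2

/-- Add the two numbers on top of the value stack. -/
def addTop : Cmd := seq (ticks .V [.T]) (seq (mv .V []) (pourAll .T [.V]))

theorem runs_addTop (i e v c m n : List Sym) (a b : ℕ) :
    Runs addTop (mk i e (enc a ++ (enc b ++ v)) c m [] n) (mk i e (enc (b + a) ++ v) c m [] n)
      (4 * a + 3) := by
  have h1 : Runs (ticks .V [.T]) (mk i e (enc a ++ (enc b ++ v)) c m [] n)
      (mk i e (sep :: (enc b ++ v)) c m (List.replicate a tick) n) (2 * a + 1) :=
    runs_ticks a (sep :: (enc b ++ v)) (by simp) (by simp) (by simp [enc]) rfl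
      (by funext j; cases j <;> simp [poured])
  have h2 : Runs (mv .V []) (mk i e (sep :: (enc b ++ v)) c m (List.replicate a tick) n)
      (mk i e (enc b ++ v) c m (List.replicate a tick) n) 1 :=
    runs_mv sep (enc b ++ v) (by simp) (by simp) rfl (by funext j; cases j <;> simp [moved])
  have h3 : Runs (pourAll .T [.V]) (mk i e (enc b ++ v) c m (List.replicate a tick) n)
      (mk i e (enc (b + a) ++ v) c m [] n) (2 * a + 1) := by
    have := runs_pourAll (k := .T) (l := [.V]) (s := mk i e (enc b ++ v) c m
      (List.replicate a tick) n) (t := mk i e (enc (b + a) ++ v) c m [] n) (by simp) (by simp)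
      (by
        funext j
        cases j <;> simp only [poured, mk_I, mk_E, mk_V, mk_C, mk_M, mk_T, mk_N] <;>
          simp [enc, Nat.add_comm b a, ← List.replicate_append_replicate])
    simpa using this
  exact (h1.seq (h2.seq h3)).mono (by omega)

/-- Subtract the top of the value stack from the number below it. -/
def subTop : Cmd :=
  seq (ticks .V [.T]) (seq (mv .V [])
    (loop .T Option.isSome (seq (mv .T []) (ite .V isTick (mv .V []) skip))))

/-- Each unit of the subtrahend cancels a unit of the other number only while one is left; after the
units `x` the value is `b - x.length`, so truncation comes for free. -/
theorem runs_subTop (i e v c m n : List Sym) (a b : ℕ) :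
    Runs subTop (mk i e (enc a ++ (enc b ++ v)) c m [] n) (mk i e (enc (b - a) ++ v) c m [] n)
      (6 * a + 3) := by
  have h1 : Runs (ticks .V [.T]) (mk i e (enc a ++ (enc b ++ v)) c m [] n)
      (mk i e (sep :: (enc b ++ v)) c m (List.replicate a tick) n) (2 * a + 1) :=
    runs_ticks a (sep :: (enc b ++ v)) (by simp) (by simp) (by simp [enc]) rfl
      (by funext j; cases j <;> simp [poured])
  have h2 : Runs (mv .V []) (mk i e (sep :: (enc b ++ v)) c m (List.replicate a tick) n)
      (mk i e (enc b ++ v) c m (List.replicate a tick) n) 1 :=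
    runs_mv sep (enc b ++ v) (by simp) (by simp) rfl (by funext j; cases j <;> simp [moved])
  have h3 := runs_loop_list (k := .T) (p := Option.isSome)
    (c := seq (mv .T []) (ite .V isTick (mv .V []) skip)) (B := 3)
    (fun x y => mk i e (enc (b - x.length) ++ v) c m y n) (List.replicate a tick)
    (fun x q y _ => by
      have h4 : Runs (mv .T []) (mk i e (enc (b - x.length) ++ v) c m (q :: y) n)
        (mk i e (enc (b - x.length) ++ v) c m y n) 1 :=
        runs_mv q y (by simp) (by simp) rfl (by funext j; cases j <;> simp [moved])
      refine (h4.seq (B := 2) ?_)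
      rcases hz : b - x.length with _ | z
      · have : b - (x ++ [q]).length = 0 := by simp; omega
        rw [this]
        exact Runs.ite_false rfl (runs_skip _)
      · have : b - (x ++ [q]).length = z := by simp; omega
        rw [this]
        exact Runs.ite_true rfl (runs_mv tick (enc z ++ v) (by simp) (by simp) rfl
          (by funext j; cases j <;> simp [moved])))
    (fun x q y => rfl) (fun x => rfl)
  simp only [List.length_nil, Nat.sub_zero, List.length_replicate] at h3
  exact (h1.seq (h2.seq h3)).mono (by omega)

/-- Push a constant on the value stack. -/
def pushConst : ℕ → Cmd
  | 0 => push .V sep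
  | a + 1 => seq (pushConst a) (push .V tick)

theorem runs_pushConst (i e v c m t n : List Sym) (a : ℕ) :
    Runs (pushConst a) (mk i e v c m t n) (mk i e (enc a ++ v) c m t n) (a + 1) := by
  induction a with
  | zero => exact runs_push (by funext j; cases j <;> simp [enc])
  | succ a ih =>
    refine ih.seq (runs_push ?_)
    funext j
    cases j <;> simp [enc, List.replicate_succ]

/-- Move `j` numbers from the environment to the auxiliary stack. -/
def dig : ℕ → Cmd
  | 0 => skip
  | j + 1 => seq (seq (ticks .E [.T]) (mv .E [.T])) (dig j)

theorem runs_dig (l : List ℕ) (i e v c m t n : List Sym) :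
    Runs (dig l.length) (mk i (encs l ++ e) v c m t n)
      (mk i e v c m ((encs l).reverse ++ t) n) (2 * (encs l).length + 1) := by
  induction l generalizing t with
  | nil => exact runs_skip _
  | cons a l ih =>
    have h1 : Runs (ticks .E [.T]) (mk i (encs (a :: l) ++ e) v c m t n)
        (mk i (sep :: (encs l ++ e)) v c m (List.replicate a tick ++ t) n) (2 * a + 1) :=
      runs_ticks a (sep :: (encs l ++ e)) (by simp) (by simp) (by simp [enc]) rfl
        (by funext j; cases j <;> simp [poured])
    have h2 : Runs (mv .E [.T]) (mk i (sep :: (encs l ++ e)) v c m (List.replicate a tick ++ t) n)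
        (mk i (encs l ++ e) v c m ((enc a).reverse ++ t) n) 1 :=
      runs_mv sep (encs l ++ e) (by simp) (by simp) rfl
        (by funext j; cases j <;> simp [moved, enc])
    have h3 := (h1.seq h2).seq (ih ((enc a).reverse ++ t))
    simp only [encs_cons, List.reverse_append, List.append_assoc, List.length_append, length_enc]
      at h3 ⊢
    exact h3.mono (by omega)

/-- Copy the `j`-th number of the environment to the value stack. -/
def pick (j : ℕ) : Cmd :=
  seq (dig j) (seq (push .V sep) (seq (ticks .E [.T, .V]) (pourAll .T [.E])))

/-- The numbers above position `j` are parked on `T`, then the units of the wanted number are sent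
to `T` and `V` at once while its separator stays on `E`. Pouring `T` back restores the environment.
-/
theorem runs_pick (l : List ℕ) (j a : ℕ) (h : l[j]? = some a) (i v c m n : List Sym) :
    Runs (pick j) (mk i (encs l) v c m [] n) (mk i (encs l) (enc a ++ v) c m [] n)
      (4 * (encs l).length + 4) := by
  obtain ⟨hj, rfl⟩ := List.getElem?_eq_some_iff.1 h
  obtain ⟨x, a, y, rfl, rfl⟩ : ∃ x a y, l = x ++ a :: y ∧ j = x.length :=
    ⟨l.take j, l[j], l.drop (j + 1), by simp, by simp; omega⟩
  rw [List.getElem_append_right (by simp)]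
  simp only [Nat.sub_self, List.getElem_cons_zero]
  have h1 := runs_dig x i (encs (a :: y)) v c m [] n
  have h2 : Runs (push .V sep) (mk i (encs (a :: y)) v c m ((encs x).reverse ++ []) n)
      (mk i (encs (a :: y)) (sep :: v) c m ((encs x).reverse ++ []) n) 1 :=
    runs_push (by funext j; cases j <;> simp)
  have h3 : Runs (ticks .E [.T, .V]) (mk i (encs (a :: y)) (sep :: v) c m
      ((encs x).reverse ++ []) n) (mk i (sep :: encs y) (enc a ++ v) c m
      (List.replicate a tick ++ (encs x).reverse) n) (2 * a + 1) :=
    runs_ticks a (sep :: encs y) (by simp) (by simp) (by simp [enc]) rfl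
      (by funext j; cases j <;> simp [poured, enc])
  have h4 := runs_pourAll (k := .T) (l := [.E]) (s := mk i (sep :: encs y) (enc a ++ v) c m
      (List.replicate a tick ++ (encs x).reverse) n)
      (t := mk i (encs (x ++ a :: y)) (enc a ++ v) c m [] n) (by simp) (by simp)
      (by funext j; cases j <;> simp [poured, enc])
  rw [← encs_append] at h1
  refine (h1.seq (h2.seq (h3.seq h4))).mono ?_
  simp
  omega

end Cmd

end StackProgram

namespace StackProgram

open Cmd

/-! ### Expressions over a store and their compilation -/

/-- A cell of the store. -/
abbrev Cell := Fin 4 → ℕ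

/-- Arithmetic expressions with sums over the cells of a store. The variables are numbered by
their binding depth: a sum at depth `d` binds the variable `d`, which stands for a cell. -/
inductive Expr
  | const (n : ℕ)
  | var (x : ℕ) (f : Fin 4)
  | add (a b : Expr)
  | sub (a b : Expr)
  | ite (c a b : Expr)
  | sum (a : Expr)

namespace Expr

/-- The value of an expression at depth `d`. -/
def eval (m : List Cell) : Expr → ℕ → (ℕ → Cell) → ℕ
  | const n, _, _ => n
  | var x f, d, env => if x < d then env x f else 0
  | add a b, d, env => eval m a d env + eval m b d env
  | sub a b, d, env => eval m a d env - eval m b d env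
  | ite c a b, d, env => if eval m c d env ≠ 0 then eval m a d env else eval m b d env
  | sum a, d, env => (m.map fun x => eval m a (d + 1) (Function.update env d x)).sum

/-- A bound for the value of an expression if the store has at most `b` cells and all numbers are
at most `b`. -/
def valBound : Expr → ℕ → ℕ
  | const n, _ => n
  | var _ _, b => b
  | add a c, b => valBound a b + valBound c b
  | sub a _, b => valBound a b
  | ite _ a c, b => valBound a b + valBound c b
  | sum a, b => b * valBound a b

/-- All entries of all cells are at most `b`. -/
def StoreLe (b : ℕ) (m : List Cell) : Prop := ∀ x ∈ m, ∀ f, x f ≤ b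

/-- A sum has at most `b` terms, so each sum costs one factor `b`. With unary numbers the value
itself bounds the cost of handling it. -/
theorem eval_le {b : ℕ} {m : List Cell} (hm : StoreLe b m) (hl : m.length ≤ b) (e : Expr) (d : ℕ)
    (env : ℕ → Cell) (he : ∀ x < d, ∀ f, env x f ≤ b) : eval m e d env ≤ valBound e b := by
  induction e generalizing d env with
  | const n => exact le_rfl
  | var x f =>
    simp only [eval, valBound]
    split_ifs with h
    · exact he x h f
    · exact Nat.zero_le _
  | add a c iha ihc => exact add_le_add (iha d env he) (ihc d env he)
  | sub a c iha ihc => exact (Nat.sub_le _ _).trans (iha d env he)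
  | ite c a a' _ iha iha' =>
    simp only [eval, valBound]
    split_ifs
    · exact (iha d env he).trans (Nat.le_add_right _ _)
    · exact (iha' d env he).trans (Nat.le_add_left _ _)
  | sum a ih =>
    simp only [eval, valBound]
    refine (List.sum_le_card_nsmul _ (valBound a b) ?_).trans ?_
    · simp only [List.mem_map]
      rintro _ ⟨x, hx, rfl⟩
      refine ih _ _ fun y hy f => ?_
      by_cases h : y = d
      · subst h; simpa using hm x hx f
      · rw [Function.update_of_ne h]
        exact he y (by omega) f
    · simpa using Nat.mul_le_mul_right _ hl

/-- The numbers in a cell. -/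
def cellNums (x : Cell) : List ℕ := [x 0, x 1, x 2, x 3]

/-- The numbers in a store. -/
def storeNums (m : List Cell) : List ℕ := m.flatMap cellNums

/-- The numbers on the environment stack. -/
def envNums : ℕ → (ℕ → Cell) → List ℕ
  | 0, _ => []
  | d + 1, env => [env d 3, env d 2, env d 1, env d 0] ++ envNums d env

theorem length_envNums (d : ℕ) (env : ℕ → Cell) : (envNums d env).length = 4 * d := by
  induction d with
  | zero => rfl
  | succ d ih => simp only [envNums, List.length_append, ih]; simp; omega

theorem envNums_le {b d : ℕ} {env : ℕ → Cell} (he : ∀ x < d, ∀ f, env x f ≤ b) :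
    ∀ a ∈ envNums d env, a ≤ b := by
  induction d with
  | zero => simp [envNums]
  | succ d ih =>
    intro a ha
    simp only [envNums, List.mem_append, List.mem_cons, List.not_mem_nil, or_false] at ha
    rcases ha with (rfl | rfl | rfl | rfl) | ha
    iterate 4 exact he d (by omega) _
    exact ih (fun x hx => he x (by omega)) a ha

/-- The innermost bound cell is on top, so `d - 1 - x` cells of four numbers lie above that of `x`.
Fields are reversed because `loadCell` moves field `0` first. -/
theorem envNums_getElem? {d x : ℕ} (env : ℕ → Cell) (hx : x < d) (f : Fin 4) :
    (envNums d env)[4 * (d - 1 - x) + (3 - f.val)]? = some (env x f) := by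
  induction d with
  | zero => omega
  | succ d ih =>
    by_cases h : x = d
    · subst h
      rw [show x + 1 - 1 - x = 0 by omega]
      fin_cases f <;> simp [envNums]
    · have hx' : x < d := by omega
      rw [← ih hx', envNums, List.getElem?_append_right (by simp; omega)]
      congr 1
      simp
      omega

theorem envNums_congr {d : ℕ} {env env' : ℕ → Cell} (h : ∀ x < d, env x = env' x) :
    envNums d env = envNums d env' := by
  induction d with
  | zero => rfl
  | succ d ih => simp only [envNums, ih fun x hx => h x (by omega), h d (by omega)]

theorem envNums_update (d : ℕ) (env : ℕ → Cell) (x : Cell) :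
    envNums (d + 1) (Function.update env d x) = [x 3, x 2, x 1, x 0] ++ envNums d env := by
  simp only [envNums, Function.update_self]
  rw [envNums_congr fun y (hy : y < d) => Function.update_of_ne (by omega) ..]

/-! ### Evaluation of expressions by stack programs -/

/-- Copy the store to the loop control stack. -/
def copyStore : Cmd := seq (push .C mark) (seq (pourAll .M [.T]) (pourAll .T [.M, .C]))

/-- The reversal on `T` is undone on `M` and `C` simultaneously. The mark below the copy lets nested
loops share the stack `C`. -/
theorem runs_copyStore (i e v c m n : List Sym) :
    Runs copyStore (mk i e v c m [] n) (mk i e v (m ++ mark :: c) m [] n) (4 * m.length + 3) := by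
  have h1 : Runs (push .C mark) (mk i e v c m [] n) (mk i e v (mark :: c) m [] n) 1 :=
    runs_push (by funext j; cases j <;> simp)
  have h2 := runs_pourAll (k := .M) (l := [.T]) (s := mk i e v (mark :: c) m [] n)
      (t := mk i e v (mark :: c) [] m.reverse n) (by simp) (by simp)
      (by funext j; cases j <;> simp [poured])
  have h3 := runs_pourAll (k := .T) (l := [.M, .C]) (s := mk i e v (mark :: c) [] m.reverse n)
      (t := mk i e v (m ++ mark :: c) m [] n) (by simp) (by simp)
      (by funext j; cases j <;> simp [poured])
  exact (h1.seq (h2.seq h3)).mono (by simp; omega)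

/-- Move a cell from the loop control stack to the environment. -/
def loadCell : Cmd :=
  seq (moveNum .C .E) (seq (moveNum .C .E) (seq (moveNum .C .E) (moveNum .C .E)))

theorem runs_loadCell {b : ℕ} (x : Cell) (hx : ∀ f, x f ≤ b) (i e v c m n : List Sym) :
    Runs loadCell (mk i e v (encs (cellNums x) ++ c) m [] n)
      (mk i (encs [x 3, x 2, x 1, x 0] ++ e) v c m [] n) (16 * b + 12) := by
  have h0 := hx 0
  have h1 := hx 1
  have h2 := hx 2
  have h3 := hx 3
  have r0 := runs_moveNum_C_E i e v (enc (x 1) ++ (enc (x 2) ++ (enc (x 3) ++ c))) m n (x 0)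
  have r1 := runs_moveNum_C_E i (enc (x 0) ++ e) v (enc (x 2) ++ (enc (x 3) ++ c)) m n (x 1)
  have r2 := runs_moveNum_C_E i (enc (x 1) ++ (enc (x 0) ++ e)) v (enc (x 3) ++ c) m n (x 2)
  have r3 := runs_moveNum_C_E i (enc (x 2) ++ (enc (x 1) ++ (enc (x 0) ++ e))) v c m n (x 3)
  simp only [cellNums, encs_cons, encs_nil, List.append_nil, List.append_assoc]
  exact (r0.seq (r1.seq (r2.seq r3))).mono (by omega)

/-- Remove a cell. -/
def dropCell (k : Stk) : Cmd := seq (dropNum k) (seq (dropNum k) (seq (dropNum k) (dropNum k)))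

theorem runs_dropCell {b : ℕ} {k : Stk} {s t : State} (a₀ a₁ a₂ a₃ : ℕ) (r : List Sym)
    (hs : s k = encs [a₀, a₁, a₂, a₃] ++ r) (h0 : a₀ ≤ b) (h1 : a₁ ≤ b) (h2 : a₂ ≤ b)
    (h3 : a₃ ≤ b) (ht : t = Function.update s k r) :
    Runs (dropCell k) s t (8 * b + 8) := by
  subst ht
  simp only [encs_cons, encs_nil, List.append_nil, List.append_assoc] at hs
  have r0 : Runs (dropNum k) s (Function.update s k (enc a₁ ++ (enc a₂ ++ (enc a₃ ++ r)))) _ :=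
    runs_dropNum a₀ _ hs rfl
  have r1 : Runs (dropNum k) (Function.update s k (enc a₁ ++ (enc a₂ ++ (enc a₃ ++ r))))
      (Function.update s k (enc a₂ ++ (enc a₃ ++ r))) _ :=
    runs_dropNum a₁ (enc a₂ ++ (enc a₃ ++ r)) (by simp) (by simp)
  have r2 : Runs (dropNum k) (Function.update s k (enc a₂ ++ (enc a₃ ++ r)))
      (Function.update s k (enc a₃ ++ r)) _ := runs_dropNum a₂ (enc a₃ ++ r) (by simp) (by simp)
  have r3 : Runs (dropNum k) (Function.update s k (enc a₃ ++ r))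
      (Function.update s k r) _ := runs_dropNum a₃ r (by simp) (by simp)
  exact (r0.seq (r1.seq (r2.seq r3))).mono (by omega)

/-- The program that evaluates an expression at depth `d` and pushes its value. -/
def compile : Expr → ℕ → Cmd
  | const n, _ => pushConst n
  | var x f, d => if x < d then pick (4 * (d - 1 - x) + (3 - f.val)) else pushConst 0
  | add a b, d => seq (compile a d) (seq (compile b d) addTop)
  | sub a b, d => seq (compile a d) (seq (compile b d) subTop)
  | ite c a b, d => seq (compile c d) (.ite .V isTick (seq (dropNum .V) (compile a d))
      (seq (dropNum .V) (compile b d)))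
  | sum a, d => seq (push .V sep) (seq copyStore (seq
      (loop .C notMark (seq loadCell (seq (compile a (d + 1)) (seq addTop (dropCell .E)))))
      (mv .C [])))

/-- A bound for the length of the code of the store. -/
def storeBound (b : ℕ) : ℕ := 4 * b * (b + 1)

/-- A bound for the running time of `compile`. -/
def timeBound : Expr → ℕ → ℕ → ℕ
  | const n, _, _ => n + 1
  | var _ _, d, b => 4 * (4 * d * (b + 1)) + 4
  | add a c, d, b => timeBound a d b + timeBound c d b + (4 * valBound c b + 3)
  | sub a c, d, b => timeBound a d b + timeBound c d b + (6 * valBound c b + 3)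
  | ite c a a', d, b =>
      timeBound c d b + timeBound a d b + timeBound a' d b + (2 * valBound c b + 3)
  | sum a, d, b => 4 * storeBound b + 6 +
      b * (16 * b + 12 + timeBound a (d + 1) b + 4 * valBound a b + 3 + (8 * b + 8) + 1)

theorem length_encs_storeNums_le {b : ℕ} {m : List Cell} (hm : StoreLe b m)
    (hl : m.length ≤ b) : (encs (storeNums m)).length ≤ storeBound b := by
  refine (length_encs_le (b := b) _ ?_).trans ?_
  · intro a ha
    simp only [storeNums, List.mem_flatMap, cellNums, List.mem_cons, List.not_mem_nil,
      or_false] at ha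
    obtain ⟨x, hx, rfl | rfl | rfl | rfl⟩ := ha <;> exact hm x hx _
  · have : (storeNums m).length = 4 * m.length := by
      induction m with
      | nil => rfl
      | cons x m ih =>
        have h := ih (fun y hy => hm y (by simp [hy])) (by simp at hl; omega)
        simp only [storeNums, List.flatMap_cons, List.length_append, List.length_cons] at h ⊢
        rw [h]
        simp [cellNums]
        omega
    rw [this]
    exact Nat.mul_le_mul_right _ (Nat.mul_le_mul_left _ hl)

/-- A loop over the cells on the loop control stack. -/
theorem runs_loop_cells {c : Cmd} {B : ℕ} (m : List Cell)
    (i : List Sym → List Cell → State) (r : List Sym)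
    (hbody : ∀ x a y, x ++ a :: y = m →
      Runs c (i (encs (cellNums a) ++ (encs (storeNums y) ++ mark :: r)) x)
        (i (encs (storeNums y) ++ mark :: r) (x ++ [a])) B)
    (hi : ∀ w x, i w x .C = w) :
    Runs (loop .C notMark c) (i (encs (storeNums m) ++ mark :: r) []) (i (mark :: r) m)
      (m.length * (B + 1) + 1) := by
  have := runs_loop_list (k := .C) (p := notMark) (c := c) (B := B)
    (fun x y => i (encs (storeNums y) ++ mark :: r) x) m
    (fun x a y h => by simpa [storeNums] using hbody x a y h)
    (fun x a y => by
      rw [hi]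
      simp only [storeNums, List.flatMap_cons, encs_append]
      -- The code of a number begins with a unit or a separator, also for zero, so only the mark
      -- stops the loop.
      cases h : a 0 <;> simp [cellNums, enc, h, notMark, List.replicate_succ])
    (fun x => by rw [hi]; rfl)
  simpa [storeNums] using this

/-- Induction on the expression, with `v` and `c` arbitrary: partial results wait below on `V` and
unfinished loops below on `C`. For a sum, the accumulator starts at zero on `V` and each pass binds
one cell on `E`, evaluates the summand and adds it. -/
theorem runs_compile {b : ℕ} {m : List Cell} (hm : StoreLe b m) (hl : m.length ≤ b) (e : Expr)
    (d : ℕ) (env : ℕ → Cell) (he : ∀ x < d, ∀ f, env x f ≤ b) (i v c n : List Sym) :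
    Runs (compile e d) (mk i (encs (envNums d env)) v c (encs (storeNums m)) [] n)
      (mk i (encs (envNums d env)) (enc (eval m e d env) ++ v) c (encs (storeNums m)) [] n)
      (timeBound e d b) := by
  induction e generalizing d env v c with
  | const a => exact runs_pushConst ..
  | var x f =>
    simp only [compile, eval]
    split_ifs with h
    · refine (runs_pick _ _ _ (envNums_getElem? env h f) ..).mono ?_
      have := length_encs_le _ (envNums_le he)
      rw [length_envNums] at this
      simp only [timeBound]
      omega
    · exact (runs_pushConst i _ v c _ _ _ 0).mono (by simp [timeBound])
  | add a a' iha iha' =>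
    have h1 := iha d env he v c
    have h2 := iha' d env he (enc (eval m a d env) ++ v) c
    have h3 := runs_addTop i (encs (envNums d env)) v c (encs (storeNums m)) n
      (eval m a' d env) (eval m a d env)
    have := eval_le hm hl a' d env he
    exact (h1.seq (h2.seq h3)).mono (by simp only [timeBound]; omega)
  | sub a a' iha iha' =>
    have h1 := iha d env he v c
    have h2 := iha' d env he (enc (eval m a d env) ++ v) c
    have h3 := runs_subTop i (encs (envNums d env)) v c (encs (storeNums m)) n
      (eval m a' d env) (eval m a d env)
    have := eval_le hm hl a' d env he
    exact (h1.seq (h2.seq h3)).mono (by simp only [timeBound]; omega)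
  | ite q a a' ihq iha iha' =>
    have h1 := ihq d env he v c
    have h2 := iha d env he v c
    have h3 := iha' d env he v c
    have h4 : Runs (dropNum .V)
        (mk i (encs (envNums d env)) (enc (eval m q d env) ++ v) c (encs (storeNums m)) [] n)
        (mk i (encs (envNums d env)) v c (encs (storeNums m)) [] n) (2 * eval m q d env + 2) :=
      runs_dropNum _ _ rfl (by funext j; cases j <;> simp)
    have := eval_le hm hl q d env he
    simp only [compile, eval]
    split_ifs with h
    · obtain ⟨z, hz⟩ := Nat.exists_eq_succ_of_ne_zero h
      refine (h1.seq (Runs.ite_true ?_ (h4.seq h2))).mono (by simp only [timeBound]; omega)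
      simp [hz, enc, List.replicate_succ]
    · refine (h1.seq (Runs.ite_false ?_ (h4.seq h3))).mono (by simp only [timeBound]; omega)
      rw [not_not] at h
      simp [h, enc]
  | sum a ih =>
    have h1 : Runs (push .V sep) (mk i (encs (envNums d env)) v c (encs (storeNums m)) [] n)
        (mk i (encs (envNums d env)) (enc 0 ++ v) c (encs (storeNums m)) [] n) 1 :=
      runs_push (by funext j; cases j <;> simp [enc])
    have h2 := runs_copyStore i (encs (envNums d env)) (enc 0 ++ v) c (encs (storeNums m)) n
    have h3 := runs_loop_cells (c := seq loadCell (seq (compile a (d + 1)) (seq addTop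
        (dropCell .E)))) (B := 16 * b + 12 + timeBound a (d + 1) b + 4 * valBound a b + 3 +
          (8 * b + 8)) m
      (fun w x => mk i (encs (envNums d env)) (enc (x.map fun y => eval m a (d + 1)
        (Function.update env d y)).sum ++ v) w (encs (storeNums m)) [] n) c
      (fun x y z h => by
        have hy : y ∈ m := by rw [← h]; simp
        have h1 := runs_loadCell y (hm y hy) i (encs (envNums d env)) (enc (x.map fun y =>
          eval m a (d + 1) (Function.update env d y)).sum ++ v)
          (encs (storeNums z) ++ mark :: c) (encs (storeNums m)) n
        have he' : ∀ x < d + 1, ∀ f, Function.update env d y x f ≤ b := by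
          intro x hx f
          by_cases hxd : x = d
          · subst hxd; simpa using hm y hy f
          · rw [Function.update_of_ne hxd]
            exact he x (by omega) f
        have h2 := ih (d + 1) (Function.update env d y) he' (enc (x.map fun y =>
          eval m a (d + 1) (Function.update env d y)).sum ++ v) (encs (storeNums z) ++ mark :: c)
        have h3 := runs_addTop i (encs (envNums (d + 1) (Function.update env d y))) v
          (encs (storeNums z) ++ mark :: c) (encs (storeNums m)) n
          (eval m a (d + 1) (Function.update env d y))
          (x.map fun y => eval m a (d + 1) (Function.update env d y)).sum
        have h4 := runs_dropCell (b := b) (k := .E) (s := mk i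
          (encs (envNums (d + 1) (Function.update env d y)))
          (enc ((x.map fun y => eval m a (d + 1) (Function.update env d y)).sum +
            eval m a (d + 1) (Function.update env d y)) ++ v)
          (encs (storeNums z) ++ mark :: c) (encs (storeNums m)) [] n)
          (t := mk i (encs (envNums d env))
          (enc ((x.map fun y => eval m a (d + 1) (Function.update env d y)).sum +
            eval m a (d + 1) (Function.update env d y)) ++ v)
          (encs (storeNums z) ++ mark :: c) (encs (storeNums m)) [] n)
          (y 3) (y 2) (y 1) (y 0) (encs (envNums d env))
          (by rw [mk_E, envNums_update, encs_append]) (hm y hy _) (hm y hy _) (hm y hy _)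
          (hm y hy _) (by funext j; cases j <;> simp)
        have hv := eval_le hm hl a (d + 1) (Function.update env d y) he'
        rw [← encs_append, ← envNums_update] at h1
        simp only [List.map_append, List.map_cons, List.map_nil, List.sum_append, List.sum_cons,
          List.sum_nil, Nat.add_zero]
        exact (h1.seq (h2.seq (h3.seq h4))).mono (by omega))
      (fun _ _ => rfl)
    have h4 : Runs (mv .C []) (mk i (encs (envNums d env)) (enc (eval m (sum a) d env) ++ v)
        (mark :: c) (encs (storeNums m)) [] n)
        (mk i (encs (envNums d env)) (enc (eval m (sum a) d env) ++ v) c (encs (storeNums m))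
        [] n) 1 :=
      runs_mv mark c (by simp) (by simp) rfl (by funext j; cases j <;> simp [moved])
    refine (h1.seq (h2.seq (h3.seq h4))).mono ?_
    have hs := length_encs_storeNums_le hm hl
    have hb := Nat.mul_le_mul_right (16 * b + 12 + timeBound a (d + 1) b + 4 * valBound a b + 3 +
          (8 * b + 8) + 1) hl
    simp only [timeBound]
    omega

end Expr

end StackProgram

namespace StackProgram

open Cmd StackProgram.Expr

/-! ### Iterated updates of a store -/

/-- Simultaneous update of all cells of a store. -/
def updateStore (u : Fin 4 → Expr) (m : List Cell) : List Cell :=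
  m.map fun x f => (u f).eval m 1 (fun _ => x)

/-- The number of a letter. -/
def letterNum : Sym → ℕ
  | some false => 0
  | some true => 1
  | none => 2

/-- The initial cell for a letter at position `j`. -/
def initCell (j : ℕ) (a : Sym) : Cell := ![j, letterNum a, 0, 0]

/-- The initial store of an input string. -/
def initStore (w : List Sym) : List Cell := (w.mapIdx initCell).reverse

/-- Evaluate an expression on the cell on the environment stack and append its value to the new
store. -/
def emit (e : Expr) : Cmd := seq (compile e 1) (seq (ticks .V [.N]) (mv .V [.N]))

theorem runs_emit {b : ℕ} {m : List Cell} (hm : StoreLe b m) (hl : m.length ≤ b) (e : Expr)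
    (x : Cell) (hx : x ∈ m) (i c n : List Sym) :
    Runs (emit e) (mk i (encs [x 3, x 2, x 1, x 0]) [] c (encs (storeNums m)) [] n)
      (mk i (encs [x 3, x 2, x 1, x 0]) [] c (encs (storeNums m)) []
        ((enc (e.eval m 1 (fun _ => x))).reverse ++ n))
      (timeBound e 1 b + 2 * valBound e b + 2) := by
  have he : ∀ y < 1, ∀ f, (fun _ => x : ℕ → Cell) y f ≤ b := fun _ _ f => hm x hx f
  have h1 := runs_compile hm hl e 1 (fun _ => x) he i [] c n
  rw [envNums, envNums, List.append_nil] at h1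
  have hv := eval_le hm hl e 1 (fun _ => x) he
  generalize e.eval m 1 (fun _ => x) = a at *
  have h2 : Runs (ticks .V [.N])
      (mk i (encs [x 3, x 2, x 1, x 0]) (enc a ++ []) c (encs (storeNums m)) [] n)
      (mk i (encs [x 3, x 2, x 1, x 0]) [sep] c (encs (storeNums m)) []
        (List.replicate a tick ++ n)) (2 * a + 1) :=
    runs_ticks a [sep] (by simp) (by simp) (by simp [enc]) rfl
      (by funext j; cases j <;> simp [poured])
  have h3 : Runs (mv .V [.N])
      (mk i (encs [x 3, x 2, x 1, x 0]) [sep] c (encs (storeNums m)) []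
        (List.replicate a tick ++ n))
      (mk i (encs [x 3, x 2, x 1, x 0]) [] c (encs (storeNums m)) []
        ((enc a).reverse ++ n)) 1 :=
    runs_mv sep [] (by simp) (by simp) rfl (by funext j; cases j <;> simp [moved, enc])
  exact (h1.seq (h2.seq h3)).mono (by omega)

/-- The program for `updateStore`. -/
def updateCmd (u : Fin 4 → Expr) : Cmd :=
  seq copyStore (seq (loop .C notMark (seq loadCell (seq (emit (u 0)) (seq (emit (u 1))
    (seq (emit (u 2)) (seq (emit (u 3)) (dropCell .E)))))))
    (seq (mv .C []) (seq (pourAll .M []) (pourAll .N [.M]))))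

/-- The time bound for the body of the loop in `updateCmd`. -/
def updateBodyBound (u : Fin 4 → Expr) (b : ℕ) : ℕ :=
  (16 * b + 12) + (timeBound (u 0) 1 b + 2 * valBound (u 0) b + 2) +
    (timeBound (u 1) 1 b + 2 * valBound (u 1) b + 2) +
    (timeBound (u 2) 1 b + 2 * valBound (u 2) b + 2) +
    (timeBound (u 3) 1 b + 2 * valBound (u 3) b + 2) + (8 * b + 8)

/-- The time bound for `updateCmd`. -/
def updateBound (u : Fin 4 → Expr) (b : ℕ) : ℕ :=
  8 * storeBound b + 10 + b * (updateBodyBound u b + 1)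

/-- The old store stays on `M` during the whole loop, so all cells are computed from the same old
values. The new cells are collected in reverse on `N`, and the last pour puts them in order; its
cost is why the new store must be bounded too. -/
theorem runs_updateCmd {b : ℕ} {m : List Cell} (hm : StoreLe b m) (hl : m.length ≤ b)
    (u : Fin 4 → Expr) (hu : StoreLe b (updateStore u m)) (i c : List Sym) :
    Runs (updateCmd u) (mk i [] [] c (encs (storeNums m)) [] [])
      (mk i [] [] c (encs (storeNums (updateStore u m))) [] []) (updateBound u b) := by
  set g : Cell → Cell := fun x f => (u f).eval m 1 (fun _ => x) with hg
  have h1 := runs_copyStore i [] [] c (encs (storeNums m)) []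
  have h2 := runs_loop_cells (c := seq loadCell (seq (emit (u 0)) (seq (emit (u 1))
    (seq (emit (u 2)) (seq (emit (u 3)) (dropCell .E)))))) (B := updateBodyBound u b) m
    (fun w x => mk i [] [] w (encs (storeNums m)) [] (encs (storeNums (x.map g))).reverse) c
    (fun x y z h => by
      have hy : y ∈ m := by rw [← h]; simp
      have h1 := runs_loadCell y (hm y hy) i [] [] (encs (storeNums z) ++ mark :: c)
        (encs (storeNums m)) (encs (storeNums (x.map g))).reverse
      rw [List.append_nil] at h1
      have e := fun f => runs_emit hm hl (u f) y hy i (encs (storeNums z) ++ mark :: c)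
      have h3 := fun n => runs_dropCell (b := b) (k := .E) (s := mk i
          (encs [y 3, y 2, y 1, y 0]) [] (encs (storeNums z) ++ mark :: c)
          (encs (storeNums m)) [] n)
          (t := mk i [] [] (encs (storeNums z) ++ mark :: c) (encs (storeNums m)) [] n)
          (y 3) (y 2) (y 1) (y 0) [] (by simp) (hm y hy _) (hm y hy _) (hm y hy _)
          (hm y hy _) (by funext j; cases j <;> simp)
      have h4 := h1.seq ((e 0 (encs (storeNums (x.map g))).reverse).seq ((e 1 _).seq ((e 2 _).seq
        ((e 3 _).seq (h3 _)))))
      have h5 : (encs (storeNums ((x ++ [y]).map g))).reverse = (enc (g y 3)).reverse ++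
          ((enc (g y 2)).reverse ++ ((enc (g y 1)).reverse ++ ((enc (g y 0)).reverse ++
            (encs (storeNums (x.map g))).reverse))) := by
        simp [storeNums, cellNums]
      rw [h5]
      exact h4.mono (by simp only [updateBodyBound]; omega))
    (fun _ _ => rfl)
  have h3 : Runs (mv .C []) (mk i [] [] (mark :: c) (encs (storeNums m)) []
      (encs (storeNums (m.map g))).reverse) (mk i [] [] c (encs (storeNums m)) []
      (encs (storeNums (m.map g))).reverse) 1 :=
    runs_mv mark c (by simp) (by simp) rfl (by funext j; cases j <;> simp [moved])
  have h4 := runs_pourAll (k := .M) (l := []) (s := mk i [] [] c (encs (storeNums m)) []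
      (encs (storeNums (m.map g))).reverse) (t := mk i [] [] c [] []
      (encs (storeNums (m.map g))).reverse) (by simp) (by simp)
      (by funext j; cases j <;> simp [poured])
  have h5 := runs_pourAll (k := .N) (l := [.M]) (s := mk i [] [] c [] []
      (encs (storeNums (m.map g))).reverse) (t := mk i [] [] c (encs (storeNums (m.map g))) []
      []) (by simp) (by simp) (by funext j; cases j <;> simp [poured])
  refine (h1.seq (h2.seq (h3.seq (h4.seq h5)))).mono ?_
  have hs := length_encs_storeNums_le hm hl
  have hs' := length_encs_storeNums_le hu (by simpa [updateStore] using hl)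
  have hb := Nat.mul_le_mul_right (updateBodyBound u b + 1) hl
  simp only [updateBound, mk_M, mk_N, List.length_reverse]
  change (encs (storeNums (m.map g))).length ≤ _ at hs'
  omega

/-- Repeat `updateCmd`, as often as there are cells in the store. -/
def iterateCmd (u : Fin 4 → Expr) : Cmd :=
  seq copyStore (seq (loop .C notMark (seq (dropCell .C) (updateCmd u))) (mv .C []))

theorem length_iterate_updateStore (u : Fin 4 → Expr) (m : List Cell) (t : ℕ) :
    ((updateStore u)^[t] m).length = m.length := by
  induction t with
  | zero => rfl
  | succ t ih => rw [Function.iterate_succ_apply', updateStore, List.length_map, ih]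

/-- A copy of the original store on `C` is the loop counter: one of its cells is discarded per
round. -/
theorem runs_iterateCmd {b : ℕ} {m : List Cell} (hl : m.length ≤ b)
    (u : Fin 4 → Expr) (hu : ∀ t, StoreLe b ((updateStore u)^[t] m)) (i c : List Sym) :
    Runs (iterateCmd u) (mk i [] [] c (encs (storeNums m)) [] [])
      (mk i [] [] c (encs (storeNums ((updateStore u)^[m.length] m))) [] [])
      (4 * storeBound b + 5 + b * (8 * b + 8 + updateBound u b + 1)) := by
  have h1 := runs_copyStore i [] [] c (encs (storeNums m)) []
  have h2 := runs_loop_cells (c := seq (dropCell .C) (updateCmd u))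
    (B := 8 * b + 8 + updateBound u b) m
    (fun w x => mk i [] [] w (encs (storeNums ((updateStore u)^[x.length] m))) [] []) c
    (fun x y z h => by
      have hy : y ∈ m := by rw [← h]; simp
      have h1 := runs_dropCell (b := b) (k := .C) (s := mk i [] []
          (encs (cellNums y) ++ (encs (storeNums z) ++ mark :: c))
          (encs (storeNums ((updateStore u)^[x.length] m))) [] [])
          (t := mk i [] [] (encs (storeNums z) ++ mark :: c)
            (encs (storeNums ((updateStore u)^[x.length] m))) [] [])
          (y 0) (y 1) (y 2) (y 3) (encs (storeNums z) ++ mark :: c) (by simp [cellNums])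
          (hu 0 y hy _) (hu 0 y hy _) (hu 0 y hy _) (hu 0 y hy _) (by funext j; cases j <;> simp)
      have h2 := runs_updateCmd (hu x.length)
        (by rwa [length_iterate_updateStore]) u
        (by rw [← Function.iterate_succ_apply' (updateStore u)]; exact hu _) i
        (encs (storeNums z) ++ mark :: c)
      rw [← Function.iterate_succ_apply' (updateStore u)] at h2
      simp only [List.length_append, List.length_singleton]
      exact h1.seq h2)
    (fun _ _ => rfl)
  have h3 : Runs (mv .C []) (mk i [] [] (mark :: c)
      (encs (storeNums ((updateStore u)^[m.length] m))) [] [])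
      (mk i [] [] c (encs (storeNums ((updateStore u)^[m.length] m))) [] []) 1 :=
    runs_mv mark c (by simp) (by simp) rfl (by funext j; cases j <;> simp [moved])
  refine (h1.seq (h2.seq h3)).mono ?_
  have hs := length_encs_storeNums_le (hu 0) hl
  have hb := Nat.mul_le_mul_right (8 * b + 8 + updateBound u b + 1) hl
  simp only [Function.iterate_zero, id] at hs
  omega

/-! ### Reading the input and producing the verdict -/

/-- Read the input and build the initial store, keeping a counter on the environment stack. -/
def initCmd : Cmd :=
  seq (loop .I Option.isSome
    (seq (push .M sep) (seq (push .M sep) (seq (push .M sep)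
    (seq (ite .I isTick (push .M tick) skip)
    (seq (ite .I (fun o => o == some mark) (seq (push .M tick) (push .M tick)) skip)
    (seq (mv .I []) (seq (push .M sep)
    (seq (ticks .E [.T, .M]) (seq (pourAll .T [.E]) (push .E tick))))))))))) (pourAll .E [])

theorem storeNums_initStore_append (x : List Sym) (a : Sym) :
    storeNums (initStore (x ++ [a])) =
      cellNums (initCell x.length a) ++ storeNums (initStore x) := by
  simp [initStore, storeNums, List.mapIdx_append]

/-- Each letter puts its cell on top of the earlier ones, hence the reversal in `initStore`. A cell
is written from field `3` down to field `0`, the latter copied from the unary position counter on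
`E`. -/
theorem runs_initCmd (w : List Sym) :
    Runs initCmd (mk w [] [] [] [] [] []) (mk [] [] [] [] (encs (storeNums (initStore w))) [] [])
      (w.length * (4 * w.length + 16 + 1) + (2 * w.length + 2)) := by
  have h1 := runs_loop_list (k := .I) (p := Option.isSome) (B := 4 * w.length + 16)
    (c := seq (push .M sep) (seq (push .M sep) (seq (push .M sep)
    (seq (ite .I isTick (push .M tick) skip)
    (seq (ite .I (fun o => o == some mark) (seq (push .M tick) (push .M tick)) skip)
    (seq (mv .I []) (seq (push .M sep)
    (seq (ticks .E [.T, .M]) (seq (pourAll .T [.E]) (push .E tick))))))))))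
    (fun x y => mk y (List.replicate x.length tick) [] [] (encs (storeNums (initStore x))) [] [])
    w
    (fun x a y h => by
      have hx : x.length ≤ w.length := by rw [← h]; simp
      rw [storeNums_initStore_append, encs_append]
      generalize encs (storeNums (initStore x)) = m
      set E := List.replicate x.length tick with hE
      have p : ∀ m, Runs (push .M sep) (mk (a :: y) E [] [] m [] [])
          (mk (a :: y) E [] [] (sep :: m) [] []) 1 := fun m =>
        runs_push (by funext j; cases j <;> simp)
      have q : Runs (seq (ite .I isTick (push .M tick) skip)
          (ite .I (fun o => o == some mark) (seq (push .M tick) (push .M tick)) skip))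
          (mk (a :: y) E [] [] (sep :: sep :: sep :: m) [] [])
          (mk (a :: y) E [] [] (encs [initCell x.length a 1, 0, 0] ++ m) [] []) 5 := by
        have pt : ∀ m, Runs (push .M tick) (mk (a :: y) E [] [] m [] [])
          (mk (a :: y) E [] [] (tick :: m) [] []) 1 := fun m =>
          runs_push (by funext j; cases j <;> simp)
        rcases a with _ | _ | _
        · exact ((Runs.ite_false rfl (runs_skip _)).seq
            (Runs.ite_true rfl ((pt _).seq (pt _)))).mono (by omega)
        · exact ((Runs.ite_false rfl (runs_skip _)).seq
            (Runs.ite_false rfl (runs_skip _))).mono (by omega)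
        · exact ((Runs.ite_true rfl (pt _)).seq
            (Runs.ite_false rfl (runs_skip _))).mono (by omega)
      -- The two tests were run together so that one case split on the letter serves both; the run
      -- is now cut in two to fit the nesting of the program.
      obtain ⟨n, hn, q⟩ := q
      cases q with
      | @seq _ _ _ s1 _ n1 n2 q1 q2 =>
      have r1 : Runs (mv .I []) (mk (a :: y) E [] [] (encs [initCell x.length a 1, 0, 0] ++ m) [] [])
          (mk y E [] [] (encs [initCell x.length a 1, 0, 0] ++ m) [] []) 1 :=
        runs_mv a y (by simp) (by simp) rfl (by funext j; cases j <;> simp [moved])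
      have r2 : Runs (push .M sep) (mk y E [] [] (encs [initCell x.length a 1, 0, 0] ++ m) [] [])
          (mk y E [] [] (sep :: (encs [initCell x.length a 1, 0, 0] ++ m)) [] []) 1 :=
        runs_push (by funext j; cases j <;> simp)
      have r3 : Runs (ticks .E [.T, .M])
          (mk y E [] [] (sep :: (encs [initCell x.length a 1, 0, 0] ++ m)) [] [])
          (mk y [] [] [] (encs (cellNums (initCell x.length a)) ++ m) E []) (2 * x.length + 1) :=
        runs_ticks x.length [] (by simp) (by simp) (by simp [E]) rfl
          (by funext j; cases j <;> simp [poured, E, cellNums, initCell, enc])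
      have r4 : Runs (pourAll .T [.E])
          (mk y [] [] [] (encs (cellNums (initCell x.length a)) ++ m) E [])
          (mk y E [] [] (encs (cellNums (initCell x.length a)) ++ m) [] [])
          (2 * E.length + 1) :=
        runs_pourAll (by simp) (by simp) (by funext j; cases j <;> simp [poured, E])
      have r5 : Runs (push .E tick)
          (mk y E [] [] (encs (cellNums (initCell x.length a)) ++ m) [] [])
          (mk y (List.replicate (x ++ [a]).length tick) [] []
            (encs (cellNums (initCell x.length a)) ++ m) [] []) 1 :=
        runs_push (by funext j; cases j <;> simp [E, List.replicate_succ])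
      refine ((p _).seq ((p _).seq ((p _).seq (Runs.seq ⟨n1, le_rfl, q1⟩ (Runs.seq ⟨n2, le_rfl, q2⟩
        (r1.seq (r2.seq (r3.seq (r4.seq r5))))))))).mono ?_
      simp only [hE, List.length_replicate]
      omega)
    (fun x a y => rfl) (fun x => rfl)
  have h2 := runs_pourAll (k := .E) (l := []) (s := mk [] (List.replicate w.length tick) [] []
      (encs (storeNums (initStore w))) [] []) (t := mk [] [] [] []
      (encs (storeNums (initStore w))) [] []) (by simp) (by simp)
      (by funext j; cases j <;> simp [poured])
  exact (h1.seq h2).mono (by simp; omega)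

/-- Evaluate the output expression, reduce its value to one bit, and empty the store. -/
def outputCmd (o : Expr) : Cmd :=
  seq (compile o 0) (seq (.ite .V isTick (seq (dropNum .V) (push .V tick)) skip) (pourAll .M []))

/-- The value is normalised to one bit and the store is erased, as the halting configuration
requires. -/
theorem runs_outputCmd {b : ℕ} {m : List Cell} (hm : StoreLe b m) (hl : m.length ≤ b) (o : Expr)
    (env : ℕ → Cell) :
    Runs (outputCmd o) (mk [] [] [] [] (encs (storeNums m)) [] [])
      (valueState [some (decide (o.eval m 0 env ≠ 0))])
      (timeBound o 0 b + 2 * valBound o b + 5 + 2 * storeBound b) := by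
  have h1 := runs_compile hm hl o 0 env (fun x hx => absurd hx (by omega)) [] [] [] []
  have hv := eval_le hm hl o 0 env (fun x hx => absurd hx (by omega))
  rw [envNums, encs_nil] at h1
  generalize o.eval m 0 env = a at *
  have h2 : Runs (.ite .V isTick (seq (dropNum .V) (push .V tick)) skip)
      (mk [] [] (enc a ++ []) [] (encs (storeNums m)) [] [])
      (mk [] [] [some (decide (a ≠ 0))] [] (encs (storeNums m)) [] []) (2 * a + 4) := by
    cases a with
    | zero => exact (Runs.ite_false rfl (runs_skip _)).mono (by omega)
    | succ a =>
      refine Runs.ite_true (by simp [enc, List.replicate_succ]) ?_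
      have h3 : Runs (dropNum .V) (mk [] [] (enc (a + 1) ++ []) [] (encs (storeNums m)) [] [])
          (mk [] [] [] [] (encs (storeNums m)) [] []) (2 * (a + 1) + 2) :=
        runs_dropNum _ _ rfl (by funext j; cases j <;> simp)
      exact h3.seq (runs_push (by funext j; cases j <;> simp))
  have h3 := runs_pourAll (k := .M) (l := []) (s := mk [] [] [some (decide (a ≠ 0))] []
      (encs (storeNums m)) [] []) (t := valueState [some (decide (a ≠ 0))]) (by simp) (by simp)
      (by funext j; cases j <;> simp [poured, valueState])
  have hs := length_encs_storeNums_le hm hl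
  refine (h1.seq (h2.seq h3)).mono ?_
  simp only [mk_M]
  omega

/-! ### Polynomiality of the time bounds -/

/-- Functions that agree with a polynomial. -/
def IsPoly (f : ℕ → ℕ) : Prop := ∃ p : Polynomial ℕ, ∀ b, f b = p.eval b

theorem isPoly_const (n : ℕ) : IsPoly fun _ => n := ⟨Polynomial.C n, by simp⟩

theorem isPoly_id : IsPoly fun b => b := ⟨Polynomial.X, by simp⟩

theorem IsPoly.add {f g : ℕ → ℕ} : IsPoly f → IsPoly g → IsPoly fun b => f b + g b
  | ⟨p, hp⟩, ⟨q, hq⟩ => ⟨p + q, by simp [hp, hq]⟩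

theorem IsPoly.mul {f g : ℕ → ℕ} : IsPoly f → IsPoly g → IsPoly fun b => f b * g b
  | ⟨p, hp⟩, ⟨q, hq⟩ => ⟨p * q, by simp [hp, hq]⟩

theorem isPoly_valBound (e : Expr) : IsPoly (valBound e) := by
  induction e with
  | const n => exact isPoly_const n
  | var => exact isPoly_id
  | add _ _ h h' => exact h.add h'
  | sub _ _ h _ => exact h
  | ite _ _ _ _ h h' => exact h.add h'
  | sum _ h => exact isPoly_id.mul h

theorem isPoly_storeBound : IsPoly storeBound :=
  ((isPoly_const 4).mul isPoly_id).mul (isPoly_id.add (isPoly_const 1))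

/-- The expression and the depth are fixed and only `b` varies; the degree grows with the nesting of
sums. -/
theorem isPoly_timeBound (e : Expr) (d : ℕ) : IsPoly (timeBound e d) := by
  induction e generalizing d with
  | const n => exact isPoly_const _
  | var =>
    exact ((isPoly_const 4).mul ((isPoly_const (4 * d)).mul (isPoly_id.add (isPoly_const 1)))).add
      (isPoly_const 4)
  | add _ c h h' =>
    exact ((h d).add (h' d)).add (((isPoly_const 4).mul (isPoly_valBound c)).add (isPoly_const 3))
  | sub _ c h h' =>
    exact ((h d).add (h' d)).add (((isPoly_const 6).mul (isPoly_valBound c)).add (isPoly_const 3))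
  | ite c _ _ h h' h'' =>
    exact (((h d).add (h' d)).add (h'' d)).add
      (((isPoly_const 2).mul (isPoly_valBound c)).add (isPoly_const 3))
  | sum a h =>
    exact (((isPoly_const 4).mul isPoly_storeBound).add (isPoly_const 6)).add (isPoly_id.mul
      (((((((isPoly_const 16).mul isPoly_id).add (isPoly_const 12)).add (h (d + 1))).add
        ((isPoly_const 4).mul (isPoly_valBound a))).add (isPoly_const 3)).add
        (((isPoly_const 8).mul isPoly_id).add (isPoly_const 8)) |>.add (isPoly_const 1)))

theorem isPoly_updateBound (u : Fin 4 → Expr) : IsPoly (updateBound u) := by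
  have h : ∀ f, IsPoly fun b => timeBound (u f) 1 b + 2 * valBound (u f) b + 2 := fun f =>
    ((isPoly_timeBound (u f) 1).add ((isPoly_const 2).mul (isPoly_valBound (u f)))).add
      (isPoly_const 2)
  exact (((isPoly_const 8).mul isPoly_storeBound).add (isPoly_const 10)).add (isPoly_id.mul
    ((((((((isPoly_const 16).mul isPoly_id).add (isPoly_const 12)).add (h 0)).add (h 1)).add
      (h 2)).add (h 3)).add (((isPoly_const 8).mul isPoly_id).add (isPoly_const 8)) |>.add
      (isPoly_const 1)))

/-- A problem is solvable in polynomial time if, for each input, the output expression is nonzero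
after as many updates of the initial store as there are letters exactly on the yes-instances, and
all numbers that occur in the store are bounded. -/
theorem polyTimeSolvableOn_of_updateStore {α : Type} (enc : α → List Sym) (yes C : α → Prop)
    (u : Fin 4 → Expr) (o : Expr)
    (hb : ∀ a, C a → ∀ t, StoreLe ((enc a).length + 2) ((updateStore u)^[t] (initStore (enc a))))
    (h : ∀ a, C a → ∃ env,
      (o.eval ((updateStore u)^[(enc a).length] (initStore (enc a))) 0 env ≠ 0 ↔ yes a)) :
    PolyTimeSolvableOn enc yes C := by
  obtain ⟨p, hp⟩ : IsPoly fun l =>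
      (l * (4 * l + 16 + 1) + (2 * l + 2)) +
        (4 * storeBound l + 5 + l * (8 * l + 8 + updateBound u l + 1) +
        (timeBound o 0 l + 2 * valBound o l + 5 + 2 * storeBound l)) := by
    refine IsPoly.add ?_ (IsPoly.add ?_ ?_)
    · exact (isPoly_id.mul ((((isPoly_const 4).mul isPoly_id).add (isPoly_const 16)).add
        (isPoly_const 1))).add
        (((isPoly_const 2).mul isPoly_id).add (isPoly_const 2))
    · exact (((isPoly_const 4).mul isPoly_storeBound).add (isPoly_const 5)).add (isPoly_id.mul
        (((((isPoly_const 8).mul isPoly_id).add (isPoly_const 8)).add (isPoly_updateBound u)).add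
          (isPoly_const 1)))
    · exact (((isPoly_timeBound o 0).add ((isPoly_const 2).mul (isPoly_valBound o))).add
        (isPoly_const 5)).add ((isPoly_const 2).mul isPoly_storeBound)
  refine polyTimeSolvableOn_of_run enc yes C (seq initCmd (seq (iterateCmd u) (outputCmd o)))
    -- The time bound is evaluated at the bound for the store entries, which is the input length
    -- plus two.
    (p.comp (Polynomial.X + 2)) fun a ha => ?_
  obtain ⟨env, he⟩ := h a ha
  refine ⟨decide (o.eval ((updateStore u)^[(enc a).length] (initStore (enc a))) 0 env ≠ 0),
    by rw [decide_eq_true_iff, he], ?_⟩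
  have hb' := hb a ha
  generalize enc a = w at hb' ⊢
  have hw : (initStore w).length = w.length := by simp [initStore]
  have h1 := runs_initCmd w
  have h2 := runs_iterateCmd (b := w.length + 2) (m := initStore w) (by omega) u hb' [] []
  rw [hw] at h2
  have h3 := runs_outputCmd (hb' w.length)
    (by rw [length_iterate_updateStore, hw]; omega) o env
  have h0 : inputState w = mk w [] [] [] [] [] [] := by
    funext k; cases k <;> simp [inputState]
  rw [h0]
  refine ((h1.seq (h2.seq h3)).mono ?_)
  have hpw := hp (w.length + 2)
  beta_reduce at hpw
  rw [Polynomial.eval_comp]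
  simp only [Polynomial.eval_add, Polynomial.eval_X, Polynomial.eval_ofNat]
  rw [← hpw]
  -- The bound for reading the input is stated at the length itself; its quadratic term has to be
  -- compared by hand.
  have := Nat.mul_le_mul (show w.length ≤ w.length + 2 by omega)
    (show 4 * w.length + 16 + 1 ≤ 4 * (w.length + 2) + 16 + 1 by omega)
  omega

end StackProgram

/-! ### Bipartite matching by an auction -/

namespace Auction

variable (n : ℕ) (need : ℕ → Prop) (cand : ℕ → ℕ → Prop)

/-- The bidder `i` has to be served, and owns none of the items below `n`; `o v = i + 1` means that
`i` owns `v`. -/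
def Unserved (o : ℕ → ℕ) (i : ℕ) : Prop := need i ∧ ∀ v < n, o v ≠ i + 1

/-- The first unserved bidder. -/
def Active (o : ℕ → ℕ) (i : ℕ) : Prop :=
  Unserved n need o i ∧ ∀ j < i, ¬ Unserved n need o j

/-- The first item of least price among the candidates of `i`. -/
def Best (p : ℕ → ℕ) (i v : ℕ) : Prop :=
  cand i v ∧ ∀ u, cand i u → p v < p u ∨ p v = p u ∧ v ≤ u

/-- The bidder `i` buys the item `v`. -/
def Buys (p o : ℕ → ℕ) (i v : ℕ) : Prop :=
  Active n need o i ∧ Best cand p i v ∧ p v ≤ n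

/-- One round of the auction: if an item is bought, then its price is raised. -/
def Round (p o p' o' : ℕ → ℕ) : Prop :=
  (∀ i v, Buys n need cand p o i v → p' v = p v + 1 ∧ o' v = i + 1) ∧
    ∀ v, (∀ i, ¬ Buys n need cand p o i v) → p' v = p v ∧ o' v = o v

/-- The invariant of the auction. -/
structure Inv (p o : ℕ → ℕ) : Prop where
  owned : ∀ v, 0 < p v → o v ≠ 0
  valid : ∀ v i, o v = i + 1 → need i ∧ cand i v
  inj : ∀ u v i, o u = i + 1 → o v = i + 1 → u = v
  slack : ∀ v i u, o v = i + 1 → cand i u → p v ≤ p u + 1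
  le : ∀ v, p v ≤ n + 1

variable {n need cand}

/-- Ties are broken by number, so a round contains at most one purchase. -/
theorem Active.unique {o : ℕ → ℕ} {i j : ℕ} (hi : Active n need o i) (hj : Active n need o j) :
    i = j := by
  rcases lt_trichotomy i j with h | h | h
  · exact absurd hi.1 (hj.2 i h)
  · exact h
  · exact absurd hj.1 (hi.2 j h)

theorem Best.unique {p : ℕ → ℕ} {i u v : ℕ} (hu : Best cand p i u) (hv : Best cand p i v) :
    u = v := by
  have h1 := hu.2 v hv.1
  have h2 := hv.2 u hu.1
  omega

/-- Prices never fall, and a bought item was a cheapest candidate before its price rose by one: this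
keeps `slack`. The buyer owned nothing before, which keeps `inj`, and buying only at a price at most
`n` keeps `le`. -/
theorem Inv.round (hc : ∀ i v, cand i v → v < n) {p o p' o' : ℕ → ℕ} (h : Inv n need cand p o)
    (hr : Round n need cand p o p' o') : Inv n need cand p' o' := by
  by_cases hb : ∃ i v, Buys n need cand p o i v
  · obtain ⟨i, v, hb⟩ := hb
    obtain ⟨hpv, hov⟩ := hr.1 i v hb
    have hne : ∀ u, u ≠ v → p' u = p u ∧ o' u = o u := fun u hu => hr.2 u fun j hj => by
      obtain rfl := hj.1.unique hb.1
      exact hu (hj.2.1.unique hb.2.1)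
    have hle : ∀ u, p u ≤ p' u := fun u => by
      by_cases hu : u = v
      · subst hu; omega
      · rw [(hne u hu).1]
    -- Being unserved only concerns items below `n`, but by `valid` every owned item is a candidate
    -- and lies there.
    have hfree : ∀ u, o u ≠ i + 1 := fun u hu => hb.1.1.2 u (hc i u (h.valid u i hu).2) hu
    refine ⟨fun u hu => ?_, fun u j hu => ?_, fun u w j hu hw => ?_, fun u j w hu hw => ?_,
      fun u => ?_⟩
    · by_cases huv : u = v
      · subst huv; omega
      · rw [(hne u huv).2]
        rw [(hne u huv).1] at hu
        exact h.owned u hu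
    · by_cases huv : u = v
      · subst huv
        obtain rfl : i = j := by omega
        exact ⟨hb.1.1.1, hb.2.1.1⟩
      · rw [(hne u huv).2] at hu
        exact h.valid u j hu
    · by_cases huv : u = v <;> by_cases hwv : w = v
      · rw [huv, hwv]
      · rw [(hne w hwv).2] at hw
        subst huv
        obtain rfl : i = j := by omega
        exact absurd hw (hfree w)
      · rw [(hne u huv).2] at hu
        subst hwv
        obtain rfl : i = j := by omega
        exact absurd hu (hfree u)
      · rw [(hne u huv).2] at hu
        rw [(hne w hwv).2] at hw
        exact h.inj u w j hu hw
    · have hw' := hle w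
      by_cases huv : u = v
      · subst huv
        obtain rfl : i = j := by omega
        have := hb.2.1.2 w hw
        omega
      · rw [(hne u huv).2] at hu
        rw [(hne u huv).1]
        have := h.slack u j w hu hw
        omega
    · by_cases huv : u = v
      · subst huv
        have := hb.2.2
        omega
      · rw [(hne u huv).1]
        exact h.le u
  · push Not at hb
    have hp : p' = p := funext fun v => (hr.2 v fun i => hb i v).1
    have ho : o' = o := funext fun v => (hr.2 v fun i => hb i v).2
    rwa [hp, ho]

/-- If all bidders can be served and some bidder is not served, then an item is bought. -/
theorem Inv.exists_buys (hc : ∀ i v, cand i v → v < n) {p o : ℕ → ℕ} (h : Inv n need cand p o)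
    {f : ℕ → ℕ} (hf : ∀ i, need i → cand i (f i)) (hinj : Set.InjOn f {i | need i})
    (hu : ∃ i, Unserved n need o i) : ∃ i v, Buys n need cand p o i v := by
  classical
  set i := Nat.find hu with hi
  have hact : Active n need o i := ⟨Nat.find_spec hu, fun j hj => Nat.find_min hu hj⟩
  have hne : ((Finset.range n).filter (cand i)).Nonempty :=
    ⟨f i, by simpa using ⟨hc _ _ (hf i hact.1.1), hf i hact.1.1⟩⟩
  obtain ⟨v₀, hv₀, hmin₀⟩ := Finset.exists_min_image _ p hne
  have hne' : ∃ v, cand i v ∧ p v = p v₀ := ⟨v₀, (Finset.mem_filter.1 hv₀).2, rfl⟩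
  set v := Nat.find hne' with hv
  have hvs := Nat.find_spec hne'
  rw [← hv] at hvs
  have hmin : ∀ u, cand i u → p v ≤ p u := fun u hu => by
    rw [hvs.2]
    exact hmin₀ u (by simpa using ⟨hc _ _ hu, hu⟩)
  have hbest : Best cand p i v := by
    refine ⟨hvs.1, fun u hu => ?_⟩
    rcases (hmin u hu).lt_or_eq with hlt | heq
    · exact Or.inl hlt
    · exact Or.inr ⟨heq, Nat.find_min' hne' ⟨hu, by rw [← heq, hvs.2]⟩⟩
  by_contra hno
  push Not at hno
  have hpv : n < p v := by
    by_contra hle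
    exact hno i v ⟨hact, hbest, by omega⟩
  -- some price level between `1` and `n` is not taken
  obtain ⟨t, ht, hgap⟩ : ∃ t ∈ Finset.Icc 1 n, ∀ u < n, p u ≠ t := by
    by_contra hcon
    push Not at hcon
    -- The item `v` costs more than `n`, so only `n - 1` items are left to fill `n` levels.
    have hsub : Finset.Icc 1 n ⊆ ((Finset.range n).erase v).image p := by
      intro t ht
      obtain ⟨u, hu, rfl⟩ := hcon t ht
      refine Finset.mem_image.2 ⟨u, Finset.mem_erase.2 ⟨?_, Finset.mem_range.2 hu⟩, rfl⟩
      rintro rfl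
      have := (Finset.mem_Icc.1 ht).2
      omega
    have hcard := (Finset.card_le_card hsub).trans Finset.card_image_le
    rw [Finset.card_erase_of_mem (Finset.mem_range.2 (hc _ _ hvs.1))] at hcard
    have := hc _ _ hvs.1
    simp at hcard
    omega
  rw [Finset.mem_Icc] at ht
  set U := (Finset.range n).filter fun u => t < p u with hU
  set J := U.image fun u => o u - 1 with hJ
  have howner : ∀ u ∈ U, o u = (o u - 1) + 1 := fun u hu => by
    have := h.owned u (by have := (Finset.mem_filter.1 hu).2; omega)
    omega
  -- Items above the gap have a positive price, hence an owner, and no bidder owns two items.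
  have hJcard : J.card = U.card := by
    refine Finset.card_image_of_injOn fun u hu w hw huw => ?_
    refine h.inj u w (o u - 1) (howner u hu) ?_
    have h1 : o u - 1 = o w - 1 := huw
    have h2 := howner w hw
    omega
  have hiJ : i ∉ J := by
    intro hi'
    obtain ⟨u, hu, huo⟩ := Finset.mem_image.1 hi'
    refine hact.1.2 u (Finset.mem_range.1 (Finset.mem_filter.1 hu).1) ?_
    rw [howner u hu, huo]
  -- An owner of an item above `t` has all candidates at price at least `t` by `slack`, and strictly
  -- above since level `t` is empty.
  have hJneed : ∀ j ∈ J, need j ∧ f j ∈ U := by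
    intro j hj
    obtain ⟨u, hu, rfl⟩ := Finset.mem_image.1 hj
    have hn := (h.valid u _ (howner u hu)).1
    have hcf := hf _ hn
    have := h.slack u _ _ (howner u hu) hcf
    have h1 := (Finset.mem_filter.1 hu).2
    have h2 := hgap _ (hc _ _ hcf)
    exact ⟨hn, Finset.mem_filter.2 ⟨Finset.mem_range.2 (hc _ _ hcf), by omega⟩⟩
  -- The matching would send `U.card + 1` bidders injectively into `U`, a violation of Hall's
  -- condition.
  have hle : (insert i J).card ≤ U.card := by
    refine Finset.card_le_card_of_injOn f ?_ ?_
    · intro j hj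
      rcases Finset.mem_insert.1 hj with rfl | hj
      · have hcf := hf _ hact.1.1
        have := hmin _ hcf
        exact Finset.mem_filter.2 ⟨Finset.mem_range.2 (hc _ _ hcf), by omega⟩
      · exact (hJneed j hj).2
    · refine hinj.mono fun j hj => ?_
      rcases Finset.mem_insert.1 hj with rfl | hj
      · exact hact.1.1
      · exact (hJneed j hj).1
  rw [Finset.card_insert_of_notMem hiJ] at hle
  omega

variable {P O : ℕ → ℕ → ℕ}

theorem inv_of_rounds (hc : ∀ i v, cand i v → v < n) (hP : ∀ v, P 0 v = 0) (hO : ∀ v, O 0 v = 0)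
    (hr : ∀ t, Round n need cand (P t) (O t) (P (t + 1)) (O (t + 1))) (t : ℕ) :
    Inv n need cand (P t) (O t) := by
  induction t with
  | zero =>
    refine ⟨fun v h => ?_, fun v i h => ?_, fun u v i h => ?_, fun v i u h => ?_, fun v => ?_⟩ <;>
      simp_all
  | succ t ih => exact ih.round hc (hr t)

/-- After sufficiently many rounds of the auction, all bidders are served if and only if there is a
matching that serves them all. -/
theorem served_iff (hc : ∀ i v, cand i v → v < n) (hP : ∀ v, P 0 v = 0) (hO : ∀ v, O 0 v = 0)
    (hr : ∀ t, Round n need cand (P t) (O t) (P (t + 1)) (O (t + 1))) {T : ℕ}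
    (hT : n * (n + 1) < T) :
    (∀ i, need i → ∃ v < n, O T v = i + 1) ↔
      ∃ f : ℕ → ℕ, (∀ i, need i → cand i (f i)) ∧ Set.InjOn f {i | need i} := by
  have hinv := inv_of_rounds hc hP hO hr
  constructor
  · intro h
    choose! f _ hf using h
    refine ⟨f, fun i hi => ((hinv T).valid _ _ (hf i hi)).2, fun i hi j hj hij => ?_⟩
    have h1 := hf i hi
    have h2 := hf j hj
    rw [hij] at h1
    omega
  · rintro ⟨f, hf, hinj⟩
    by_contra hcon
    have huT : ∃ i, Unserved n need (O T) i := by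
      push Not at hcon
      exact hcon
    -- Once everybody is served no purchase occurs and the owners stay fixed; so an unserved bidder
    -- at time `T` forces one at every earlier time.
    have hu : ∀ t ≤ T, ∃ i, Unserved n need (O t) i := by
      intro t ht
      by_contra hno
      have hstay : ∀ s, O (t + s) = O t := by
        intro s
        induction s with
        | zero => rfl
        | succ s ih =>
          rw [← ih]
          funext v
          refine ((hr (t + s)).2 v fun i hi => ?_).2
          have := hi.1.1
          rw [ih] at this
          exact hno ⟨i, this⟩
      obtain ⟨s, rfl⟩ := Nat.exists_eq_add_of_le ht
      rw [hstay] at huT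
      exact hno huT
    -- Every round up to `T` has a purchase and so raises the sum of the prices.
    have hsum : ∀ t ≤ T, t ≤ ∑ v ∈ Finset.range n, P t v := by
      intro t
      induction t with
      | zero => simp
      | succ t ih =>
        intro ht
        refine (Nat.succ_le_succ (ih (by omega))).trans (Nat.succ_le_of_lt ?_)
        obtain ⟨i, v, hb⟩ := (hinv t).exists_buys hc hf hinj (hu t (by omega))
        have hvn : v < n := hc i v hb.2.1.1
        refine Finset.sum_lt_sum (fun u _ => ?_) ⟨v, Finset.mem_range.2 hvn, ?_⟩
        · by_cases hub : ∃ j, Buys n need cand (P t) (O t) j u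
          · obtain ⟨j, hj⟩ := hub
            rw [((hr t).1 j u hj).1]
            omega
          · push Not at hub
            exact ((hr t).2 u hub).1.ge
        · rw [((hr t).1 i v hb).1]
          omega
    have h1 := hsum T le_rfl
    have h2 : ∑ v ∈ Finset.range n, P T v ≤ n * (n + 1) := by
      refine (Finset.sum_le_card_nsmul _ _ (n + 1) fun v _ => (hinv T).le v).trans ?_
      simp
    omega

end Auction

/-! ### Connected sets in graphs without induced paths on four vertices -/

namespace SimpleGraph

variable {V : Type*} {G : SimpleGraph V}

/-- The adjacencies already force four distinct vertices: for instance `a = c` would turn the edge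
`c d` into the forbidden `a d`. -/
theorem false_of_induced_path (hG : ¬ (pathGraph 4).IsIndContained G) {a b c d : V}
    (hab : G.Adj a b) (hbc : G.Adj b c) (hcd : G.Adj c d) (hac : ¬ G.Adj a c)
    (hbd : ¬ G.Adj b d) (had : ¬ G.Adj a d) : False := by
  have nac : a ≠ c := by rintro rfl; exact had hcd
  have nbd : b ≠ d := by rintro rfl; exact had hab
  have nad : a ≠ d := by rintro rfl; exact hac hcd.symm
  have nab := hab.ne
  have nbc := hbc.ne
  have ncd := hcd.ne
  have hba := hab.symm
  have hcb := hbc.symm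
  have hdc := hcd.symm
  have hca : ¬ G.Adj c a := fun h => hac h.symm
  have hdb : ¬ G.Adj d b := fun h => hbd h.symm
  have hda : ¬ G.Adj d a := fun h => had h.symm
  refine hG ⟨⟨⟨![a, b, c, d], ?_⟩, ?_⟩⟩
  · intro x y h
    fin_cases x <;> fin_cases y <;> simp_all
  · intro x y
    change G.Adj (![a, b, c, d] x) (![a, b, c, d] y) ↔ (pathGraph 4).Adj x y
    fin_cases x <;> fin_cases y <;> simp_all [pathGraph_adj]

/-- In a set, two vertices are equal, adjacent, or have a common neighbour. -/
def Near (G : SimpleGraph V) (S : Set V) (u v : V) : Prop :=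
  u = v ∨ G.Adj u v ∨ ∃ w ∈ S, G.Adj u w ∧ G.Adj v w

/-- Induction along a walk: when a step `u x` is put before a path `x w v`, either a chord shortens
it or `u x w v` is an induced path. -/
theorem near_of_reachable (hG : ¬ (pathGraph 4).IsIndContained G) {S : Set V} {u v : S}
    (h : (G.induce S).Reachable u v) : Near G S u v := by
  obtain ⟨p⟩ := h
  induction p with
  | nil => exact Or.inl rfl
  | @cons u x v hux _ ih =>
    have hux : G.Adj u x := hux
    rcases ih with h | h | ⟨w, hw, hxw, hvw⟩
    · exact Or.inr (Or.inl (h ▸ hux))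
    · exact Or.inr (Or.inr ⟨x, x.2, hux, h.symm⟩)
    · by_cases h1 : G.Adj u v
      · exact Or.inr (Or.inl h1)
      by_cases h2 : G.Adj u w
      · exact Or.inr (Or.inr ⟨w, hw, h2, hvw⟩)
      by_cases h3 : G.Adj x v
      · exact Or.inr (Or.inr ⟨x, x.2, hux, h3.symm⟩)
      exact (false_of_induced_path hG hux hxw hvw.symm h2 h3 h1).elim

/-- This replaces a search for paths by three bounded quantifiers over vertices, which an expression
can evaluate. -/
theorem connected_induce_iff_near (hG : ¬ (pathGraph 4).IsIndContained G) (S : Set V) :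
    (G.induce S).Connected ↔ S.Nonempty ∧ ∀ u ∈ S, ∀ v ∈ S, Near G S u v := by
  constructor
  · intro h
    have := h.nonempty
    exact ⟨Set.nonempty_coe_sort.1 this, fun u hu v hv =>
      near_of_reachable hG (h.preconnected ⟨u, hu⟩ ⟨v, hv⟩)⟩
  · rintro ⟨hne, h⟩
    have := hne.to_subtype
    refine ⟨fun u v => ?_⟩
    rcases h u u.2 v v.2 with huv | huv | ⟨w, hw, huw, hvw⟩
    · rw [Subtype.ext huv]
    · exact Adj.reachable (G := G.induce S) huv
    · exact (Adj.reachable (G := G.induce S) (v := ⟨w, hw⟩) huw).trans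
        (Adj.reachable (G := G.induce S) (u := ⟨w, hw⟩) hvw.symm)

/-- A vertex with neighbours in two components of a set is adjacent to all vertices of each
component in which it has a neighbour. -/
theorem adj_of_reachable (hG : ¬ (pathGraph 4).IsIndContained G) {Z : Set V} {v : V} {a b c : Z}
    (hva : G.Adj v a) (hvc : G.Adj v c) (hac : ¬ (G.induce Z).Reachable a c)
    (hab : (G.induce Z).Reachable a b) : G.Adj v b := by
  obtain ⟨p⟩ := hab
  induction p with
  | nil => exact hva
  | @cons a x b hax _ ih =>
    have hxc : ¬ (G.induce Z).Reachable x c := fun h => hac (hax.reachable.trans h)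
    refine ih ?_ hxc
    -- Otherwise `x a v c` is an induced path.
    by_contra hvx
    have hax' : G.Adj a x := hax
    exact false_of_induced_path hG hax'.symm hva.symm hvc (fun h => hvx h.symm)
      (fun h => hac (Adj.reachable (G := G.induce Z) h))
      (fun h => hxc (Adj.reachable (G := G.induce Z) h))

/-- A disconnected subset of a connected set `S` is dominated by a vertex of `S`. -/
theorem exists_complete_vertex [Finite V] (hG : ¬ (pathGraph 4).IsIndContained G) {S Z : Set V}
    (hZS : Z ⊆ S) (hS : (G.induce S).Connected) (hZ : ¬ (G.induce Z).Connected) :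
    ∃ v ∈ S, v ∉ Z ∧ ∀ z ∈ Z, G.Adj z v := by
  obtain ⟨⟨s, hs⟩, hnear⟩ := (connected_induce_iff_near hG S).1 hS
  rcases Z.eq_empty_or_nonempty with rfl | hne
  -- The empty set is not connected, and every vertex dominates it.
  · exact ⟨s, hs, by simp, by simp⟩
  have := hne.to_subtype
  set R := (G.induce Z).Reachable with hR
  have hRadj : ∀ {a b : Z}, G.Adj a b → R a b := fun h => Adj.reachable (G := G.induce Z) h
  obtain ⟨a, b, hab⟩ : ∃ a b : Z, ¬ R a b := by
    by_contra h
    push Not at h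
    exact hZ ⟨h⟩
  -- two vertices in different components have a common neighbour
  have hcommon : ∀ a b : Z, ¬ R a b → ∃ w ∈ S, G.Adj w a ∧ G.Adj w b := by
    intro a b hab
    rcases hnear a (hZS a.2) b (hZS b.2) with h | h | ⟨w, hw, h1, h2⟩
    · exact absurd (Subtype.ext h ▸ Reachable.refl _) hab
    · exact absurd (hRadj h) hab
    · exact ⟨w, hw, h1.symm, h2.symm⟩
  -- The vertices of `S` that join two components of `Z`.
  set W : Set V := {v | v ∈ S ∧ ∃ a b : Z, G.Adj v a ∧ G.Adj v b ∧ ¬ R a b} with hW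
  have hWne : W.Nonempty := by
    obtain ⟨w, hw, h1, h2⟩ := hcommon a b hab
    exact ⟨w, hw, a, b, h1, h2, hab⟩
  obtain ⟨v, ⟨hvS, a, b, hva, hvb, hab⟩, hmax⟩ :=
    Set.exists_max_image W (fun v => {z | z ∈ Z ∧ G.Adj v z}.ncard) (Set.toFinite _) hWne
  refine ⟨v, hvS, fun hvZ => hab ?_, fun d hd => ?_⟩
  · exact (hRadj (a := ⟨v, hvZ⟩) hva).symm.trans (hRadj (a := ⟨v, hvZ⟩) hvb)
  by_contra hdv
  have hvd : ¬ G.Adj v d := fun h => hdv h.symm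
  have had : ¬ R a ⟨d, hd⟩ := fun h => hvd (adj_of_reachable hG hva hvb hab h)
  obtain ⟨w, hwS, hwa, hwd⟩ := hcommon a ⟨d, hd⟩ had
  have hle := hmax w ⟨hwS, a, ⟨d, hd⟩, hwa, hwd, had⟩
  -- Since `d` is a neighbour of `w` but not of `v`, maximality of `v` yields a neighbour `c` of `v`
  -- that `w` misses.
  obtain ⟨c, ⟨hcZ, hvc⟩, hwc⟩ : ∃ c, c ∈ {z | z ∈ Z ∧ G.Adj v z} ∧ ¬ G.Adj w c := by
    by_contra hcon
    push Not at hcon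
    refine absurd (Set.ncard_lt_ncard (t := {z | z ∈ Z ∧ G.Adj w z}) ?_ (Set.toFinite _))
      (not_lt.2 hle)
    refine ⟨fun c hc => ⟨hc.1, hcon c hc⟩, fun h => ?_⟩
    exact hvd (h ⟨hd, hwd⟩).2
  -- One of `a`, `b` lies outside the component of `c`, so `v` is complete to that component, which
  -- therefore cannot contain `d`.
  have hcd : ¬ R ⟨c, hcZ⟩ ⟨d, hd⟩ := by
    intro h
    by_cases hca : R ⟨c, hcZ⟩ a
    · by_cases hcb : R ⟨c, hcZ⟩ b
      · exact hab (hca.symm.trans hcb)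
      · exact hvd (adj_of_reachable hG (a := ⟨c, hcZ⟩) (b := ⟨d, hd⟩) hvc hvb hcb h)
    · exact hvd (adj_of_reachable hG (a := ⟨c, hcZ⟩) (b := ⟨d, hd⟩) hvc hva hca h)
  have hcd' : ¬ G.Adj c d := fun h => hcd (hRadj (a := ⟨c, hcZ⟩) (b := ⟨d, hd⟩) h)
  -- The induced path is `c v w d` or `c v a w`. In the second case an edge `c a` is excluded
  -- because `w` is complete to the component of `a`.
  by_cases hvw : G.Adj v w
  · exact false_of_induced_path hG hvc.symm hvw hwd (fun h => hwc h.symm) hvd hcd'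
  · refine false_of_induced_path hG hvc.symm hva hwa.symm (fun h => hwc ?_) hvw
      (fun h => hwc h.symm)
    exact adj_of_reachable hG (a := a) (b := ⟨c, hcZ⟩) hwa hwd had
      (hRadj (a := ⟨c, hcZ⟩) h).symm

/-- A set dominated by a vertex `v` becomes connected if `v` is added. -/
theorem connected_induce_insert {Z : Set V} {v : V} (h : ∀ z ∈ Z, G.Adj z v) :
    (G.induce (insert v Z)).Connected := by
  have : Nonempty (insert v Z : Set V) := ⟨⟨v, Set.mem_insert ..⟩⟩
  have key : ∀ x : (insert v Z : Set V), (G.induce (insert v Z)).Reachable x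
      ⟨v, Set.mem_insert ..⟩ := by
    rintro ⟨x, rfl | hx⟩
    · exact Reachable.refl _
    · exact Adj.reachable (G := G.induce (insert v Z)) (h x hx)
  exact ⟨fun x y => (key x).trans (key y).symm⟩

end SimpleGraph

/-! ### Reduction to bipartite matching -/

namespace DCSInstance

variable (I : DCSInstance)

/-- Adjacency of numbers of vertices. -/
def AdjN (u v : ℕ) : Prop := ∃ (hu : u < I.n) (hv : v < I.n), I.G.Adj ⟨u, hu⟩ ⟨v, hv⟩

/-- The `i`-th terminal set contains the vertex number `v`. -/
def MemN (i v : ℕ) : Prop := ∃ (hi : i < I.k) (hv : v < I.n), (⟨v, hv⟩ : Fin I.n) ∈ I.Z ⟨i, hi⟩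

/-- The `i`-th terminal set is not connected. -/
def NeedN (i : ℕ) : Prop :=
  i < I.k ∧ ¬ ((∃ u, I.MemN i u) ∧ ∀ u v, I.MemN i u → I.MemN i v →
    u = v ∨ I.AdjN u v ∨ ∃ w, I.MemN i w ∧ I.AdjN u w ∧ I.AdjN v w)

/-- The vertex `v` is in no terminal set and adjacent to all vertices of the `i`-th one. -/
def CandN (i v : ℕ) : Prop :=
  v < I.n ∧ (∀ j, ¬ I.MemN j v) ∧ ∀ u, I.MemN i u → I.AdjN u v

theorem needN_iff (hI : I.IsP4Free) (i : Fin I.k) :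
    I.NeedN i ↔ ¬ (I.G.induce (I.Z i)).Connected := by
  rw [SimpleGraph.connected_induce_iff_near hI, NeedN, and_iff_right i.2, not_iff_not]
  have hmem : ∀ v : Fin I.n, I.MemN i v ↔ v ∈ I.Z i := fun v =>
    ⟨fun ⟨_, _, h⟩ => h, fun h => ⟨i.2, v.2, h⟩⟩
  have hadj : ∀ u v : Fin I.n, I.AdjN u v ↔ I.G.Adj u v := fun u v =>
    ⟨fun ⟨_, _, h⟩ => h, fun h => ⟨u.2, v.2, h⟩⟩
  constructor
  · rintro ⟨⟨u, hu⟩, h⟩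
    refine ⟨⟨⟨u, hu.2.1⟩, (hmem ⟨u, hu.2.1⟩).1 hu⟩, fun u hu v hv => ?_⟩
    rcases h u v ((hmem u).2 hu) ((hmem v).2 hv) with h | h | ⟨w, hw, h1, h2⟩
    · exact Or.inl (Fin.ext h)
    · exact Or.inr (Or.inl ((hadj u v).1 h))
    · exact Or.inr (Or.inr ⟨⟨w, hw.2.1⟩, (hmem ⟨w, hw.2.1⟩).1 hw, (hadj u ⟨w, hw.2.1⟩).1 h1,
        (hadj v ⟨w, hw.2.1⟩).1 h2⟩)
  · rintro ⟨⟨u, hu⟩, h⟩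
    refine ⟨⟨u, (hmem u).2 hu⟩, fun u v hu hv => ?_⟩
    rcases h ⟨u, hu.2.1⟩ ((hmem ⟨u, hu.2.1⟩).1 hu) ⟨v, hv.2.1⟩ ((hmem ⟨v, hv.2.1⟩).1 hv) with
      h | h | ⟨w, hw, h1, h2⟩
    · exact Or.inl (by simpa using h)
    · exact Or.inr (Or.inl ⟨hu.2.1, hv.2.1, h⟩)
    · exact Or.inr (Or.inr ⟨w, (hmem w).2 hw, ⟨hu.2.1, w.2, h1⟩, ⟨hv.2.1, w.2, h2⟩⟩)

/-- A `P₄`-free instance is a yes-instance if and only if distinct vertices outside the terminal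
sets can be assigned to the disconnected terminal sets such that they dominate them. -/
theorem isYes_iff (hI : I.IsP4Free) :
    I.IsYes ↔ ∃ f : ℕ → ℕ, (∀ i, I.NeedN i → I.CandN i (f i)) ∧ Set.InjOn f {i | I.NeedN i} := by
  constructor
  · rintro ⟨S, hdisj, hconn, hsub⟩
    -- The dominating vertex is chosen inside `S i`, hence avoids the other terminal sets;
    -- disjointness of the `S i` will make the choices distinct.
    have key : ∀ i, I.NeedN i → ∃ v, ∃ (hi : i < I.k) (hv : v < I.n),
        (⟨v, hv⟩ : Fin I.n) ∈ S ⟨i, hi⟩ ∧ I.CandN i v := by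
      intro i hi
      have hn := (I.needN_iff hI ⟨i, hi.1⟩).1 hi
      obtain ⟨v, hvS, hvZ, hv⟩ := SimpleGraph.exists_complete_vertex hI (hsub ⟨i, hi.1⟩)
        (hconn ⟨i, hi.1⟩) hn
      refine ⟨v, hi.1, v.2, hvS, v.2, ?_, ?_⟩
      · rintro j ⟨hj, _, hvj⟩
        by_cases hij : j = i
        · subst hij; exact hvZ hvj
        · exact Set.disjoint_left.1 (hdisj ⟨j, hj⟩ ⟨i, hi.1⟩ (by simpa using hij))
            (hsub _ hvj) hvS
      · rintro u ⟨_, hu, huZ⟩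
        exact ⟨hu, v.2, hv _ huZ⟩
    choose! f hf using key
    refine ⟨f, fun i hi => (hf i hi).2.2.2, fun i hi j hj hij => ?_⟩
    obtain ⟨h1, h2, h3, _⟩ := hf i hi
    obtain ⟨h1', h2', h3', _⟩ := hf j hj
    by_contra hne
    refine Set.disjoint_left.1 (hdisj ⟨i, h1⟩ ⟨j, h1'⟩ (by simpa using hne)) h3 ?_
    simpa only [hij] using h3'
  · rintro ⟨f, hf, hinj⟩
    have hfree : ∀ i (v : Fin I.n), I.NeedN i → (v : ℕ) = f i → ∀ j, v ∉ I.Z j :=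
      fun i v hi hv j hj => (hf i hi).2.1 j ⟨j.2, hv ▸ v.2, by simpa only [← hv] using hj⟩
    refine ⟨fun i => {v | v ∈ I.Z i ∨ I.NeedN i ∧ (v : ℕ) = f i}, ?_, ?_, ?_⟩
    · intro i j hij
      refine Set.disjoint_left.2 ?_
      rintro v (hv | ⟨hi, hv⟩) (hv' | ⟨hj, hv'⟩)
      · exact Set.disjoint_left.1 (I.disjoint i j hij) hv hv'
      · exact hfree j v hj hv' i hv
      · exact hfree i v hi hv j hv'
      · exact hij (Fin.ext (hinj hi hj (hv.symm.trans hv')))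
    · intro i
      by_cases hi : I.NeedN i
      · obtain ⟨hn, -, hadj⟩ := hf i hi
        have hset : {v | v ∈ I.Z i ∨ I.NeedN i ∧ (v : ℕ) = f i} =
            insert (⟨f i, hn⟩ : Fin I.n) (I.Z i) := by
          ext v
          simp [hi, Fin.ext_iff, or_comm]
        beta_reduce
        rw [hset]
        refine SimpleGraph.connected_induce_insert fun z hz => ?_
        exact (hadj z ⟨i.2, z.2, hz⟩).2.2
      · have hset : {v | v ∈ I.Z i ∨ I.NeedN i ∧ (v : ℕ) = f i} = I.Z i := by
          ext v
          simp [hi]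
        beta_reduce
        rw [hset]
        rw [needN_iff I hI] at hi
        exact not_not.1 hi
    · exact fun i v hv => Or.inl hv

end DCSInstance

namespace StackProgram

namespace Expr

/-! ### Formulas -/

/-- Conjunction of truth values. -/
def conj (a b : Expr) : Expr := ite a b (const 0)

/-- Disjunction of truth values. -/
def disj (a b : Expr) : Expr := ite a (const 1) b

/-- Negation of a truth value. -/
def neg (a : Expr) : Expr := ite a (const 0) (const 1)

/-- Implication of truth values. -/
def imp (a b : Expr) : Expr := ite a b (const 1)

/-- Comparison of numbers. -/
def lt (a b : Expr) : Expr := sub b a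

/-- Equality of numbers. -/
def eq (a b : Expr) : Expr := neg (add (sub a b) (sub b a))

/-- Universal quantification over the cells of the store. -/
def all (a : Expr) : Expr := neg (sum (neg a))

end Expr

/-! ### Stores as functions of the position, and truth of formulas -/

/-- A store with numbered cells that contain a letter, a price and an owner each. -/
structure Layout where
  /-- the number of cells -/
  len : ℕ
  /-- the letters -/
  letter : ℕ → ℕ
  /-- the prices -/
  price : ℕ → ℕ
  /-- the owners -/
  owner : ℕ → ℕ

namespace Layout

open StackProgram.Expr

variable (S : Layout)

/-- The cell number `j`. -/
def cell (j : ℕ) : Cell := ![j, S.letter j, S.price j, S.owner j]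

/-- The list of cells. -/
def store : List Cell := ((List.range S.len).map S.cell).reverse

/-- The value of an expression at depth `d`, where the variable `x` stands for the cell `e x`. -/
def ev (a : Expr) (d : ℕ) (e : ℕ → ℕ) : ℕ := a.eval S.store d fun x => S.cell (e x)

/-- The truth of a formula. -/
def Holds (a : Expr) (d : ℕ) (e : ℕ → ℕ) : Prop := S.ev a d e ≠ 0

@[simp] theorem cell_zero (j : ℕ) : S.cell j 0 = j := rfl
@[simp] theorem cell_one (j : ℕ) : S.cell j 1 = S.letter j := rfl
@[simp] theorem cell_two (j : ℕ) : S.cell j 2 = S.price j := rfl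
@[simp] theorem cell_three (j : ℕ) : S.cell j 3 = S.owner j := rfl

variable {d : ℕ} {e : ℕ → ℕ} {a b c : Expr}

@[simp] theorem ev_const (n : ℕ) : S.ev (const n) d e = n := rfl

theorem ev_var {x : ℕ} (h : x < d) (f : Fin 4) : S.ev (var x f) d e = S.cell (e x) f := if_pos h

@[simp] theorem ev_add : S.ev (add a b) d e = S.ev a d e + S.ev b d e := rfl

@[simp] theorem ev_sub : S.ev (sub a b) d e = S.ev a d e - S.ev b d e := rfl

open Classical in
theorem ev_ite : S.ev (ite a b c) d e = if S.Holds a d e then S.ev b d e else S.ev c d e := by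
  rw [ev, eval, Holds]
  split_ifs <;> simp_all [ev]

theorem ev_sum : S.ev (sum a) d e =
    ∑ j ∈ Finset.range S.len, S.ev a (d + 1) (Function.update e d j) := by
  have h : ∀ j, Function.update (fun x => S.cell (e x)) d (S.cell j) =
      fun x => S.cell (Function.update e d j x) := by
    intro j
    funext x
    by_cases hx : x = d
    · subst hx; simp
    · simp [hx]
  simp only [ev, eval]
  rw [store, List.map_reverse, List.sum_reverse, List.map_map]
  simp only [Function.comp_def, h]
  rfl

@[simp] theorem holds_sum : S.Holds (sum a) d e ↔
    ∃ j < S.len, S.Holds a (d + 1) (Function.update e d j) := by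
  simp only [Holds, ev_sum, ne_eq, Finset.sum_eq_zero_iff, Finset.mem_range]
  push Not
  rfl

@[simp] theorem holds_const_zero : ¬ S.Holds (const 0) d e := by simp [Holds]

@[simp] theorem holds_const_one : S.Holds (const 1) d e := by simp [Holds]

theorem holds_ite : S.Holds (ite a b c) d e ↔
    (S.Holds a d e ∧ S.Holds b d e) ∨ (¬ S.Holds a d e ∧ S.Holds c d e) := by
  rw [Holds, ev_ite]
  by_cases h : S.Holds a d e
  · rw [if_pos h]
    simp [h, ← Holds.eq_1]
  · rw [if_neg h]
    simp [h, ← Holds.eq_1]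

@[simp] theorem holds_conj : S.Holds (conj a b) d e ↔ S.Holds a d e ∧ S.Holds b d e := by
  simp [conj, holds_ite]

@[simp] theorem holds_disj : S.Holds (disj a b) d e ↔ S.Holds a d e ∨ S.Holds b d e := by
  simp only [disj, holds_ite, holds_const_one]
  tauto

@[simp] theorem holds_neg : S.Holds (neg a) d e ↔ ¬ S.Holds a d e := by
  simp [neg, holds_ite]

@[simp] theorem holds_imp : S.Holds (imp a b) d e ↔ (S.Holds a d e → S.Holds b d e) := by
  simp only [imp, holds_ite, holds_const_one]
  tauto

@[simp] theorem holds_lt : S.Holds (lt a b) d e ↔ S.ev a d e < S.ev b d e := by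
  simp only [Holds, lt, ev_sub]
  omega

@[simp] theorem holds_eq : S.Holds (eq a b) d e ↔ S.ev a d e = S.ev b d e := by
  simp only [eq, holds_neg]
  simp only [Holds, ev_add, ev_sub]
  omega

@[simp] theorem holds_all : S.Holds (all a) d e ↔
    ∀ j < S.len, S.Holds a (d + 1) (Function.update e d j) := by
  simp [all]

end Layout

end StackProgram

namespace StackProgram

namespace Expr

/-! ### The algorithm as formulas -/

/-- The product of the number of the cell `u` and the successor of that of `n`. -/
def row (n u d : ℕ) : Expr :=
  sum (ite (lt (var d 0) (var u 0)) (add (var n 0) (const 1)) (const 0))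

/-- Adjacency of the vertices `u` and `v`. -/
def adj (n u v d : ℕ) : Expr :=
  conj (lt (var u 0) (var n 0)) (conj (lt (var v 0) (var n 0))
    (sum (conj (eq (var d 0) (add (row n u (d + 1)) (var v 0))) (eq (var d 1) (const 1)))))

/-- The position before the code of the `i`-th terminal set. -/
def setPos (n i d : ℕ) : Expr := add (add (row n n d) (const 1)) (row n i d)

/-- The vertex `v` is in the `i`-th terminal set. -/
def mem (n i v d : ℕ) : Expr :=
  conj (lt (var v 0) (var n 0))
    (sum (conj (eq (var d 0) (add (setPos n i (d + 1)) (var v 0))) (eq (var d 1) (const 1))))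

/-- The `i`-th terminal set exists and is not connected. -/
def need (n i d : ℕ) : Expr :=
  conj (sum (eq (var d 0) (setPos n i (d + 1))))
    (neg (conj (sum (mem n i d (d + 1)))
      (all (all (imp (mem n i d (d + 2)) (imp (mem n i (d + 1) (d + 2))
        (disj (eq (var d 0) (var (d + 1) 0)) (disj (adj n d (d + 1) (d + 2))
          (sum (conj (mem n i (d + 2) (d + 3)) (conj (adj n d (d + 2) (d + 3))
            (adj n (d + 1) (d + 2) (d + 3)))))))))))))

/-- The vertex `v` is free and dominates the `i`-th terminal set. -/
def cand (n i v d : ℕ) : Expr :=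
  conj (lt (var v 0) (var n 0)) (conj (all (neg (mem n d v (d + 1))))
    (all (imp (mem n i d (d + 1)) (adj n d v (d + 1)))))

/-- The `i`-th terminal set has to be served and owns no vertex. -/
def unserved (n i d : ℕ) : Expr :=
  conj (need n i d) (all (imp (lt (var d 0) (var n 0))
    (neg (eq (var d 3) (add (var i 0) (const 1))))))

/-- The `i`-th terminal set is the first unserved one. -/
def active (n i d : ℕ) : Expr :=
  conj (unserved n i d) (all (imp (lt (var d 0) (var i 0)) (neg (unserved n d (d + 1)))))

/-- The vertex `v` is the first candidate of least price for the `i`-th terminal set. -/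
def best (n i v d : ℕ) : Expr :=
  conj (cand n i v d) (all (imp (cand n i d (d + 1)) (disj (lt (var v 2) (var d 2))
    (conj (eq (var v 2) (var d 2)) (neg (lt (var d 0) (var v 0)))))))

/-- The `i`-th terminal set buys the vertex `v`. -/
def buys (n i v d : ℕ) : Expr :=
  conj (active n i d) (conj (best n i v d) (neg (lt (var n 0) (var v 2))))

/-- Evaluate an expression after binding the first cell that contains the separator. -/
def bindFirst (d : ℕ) (a : Expr) : Expr :=
  sum (ite (conj (eq (var d 1) (const 2)) (all (imp (lt (var (d + 1) 0) (var d 0))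
    (neg (eq (var (d + 1) 1) (const 2)))))) a (const 0))

/-- The new price of a vertex. -/
def newPrice : Expr :=
  bindFirst 1 (ite (sum (buys 1 2 0 3)) (add (var 0 2) (const 1)) (var 0 2))

/-- The new owner of a vertex. -/
def newOwner : Expr :=
  bindFirst 1 (ite (sum (buys 1 2 0 3)) (sum (ite (buys 1 2 0 3) (add (var 2 0) (const 1))
    (const 0))) (var 0 3))

/-- The update of all cells in one round of the auction. -/
def roundUpdate : Fin 4 → Expr := ![var 0 0, var 0 1, newPrice, newOwner]

/-- All terminal sets that have to be served are served. -/
def allServed : Expr :=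
  bindFirst 0 (all (imp (need 0 1 2) (sum (conj (lt (var 2 0) (var 0 0))
    (eq (var 2 3) (add (var 1 0) (const 1)))))))

end Expr

/-! ### Meaning of the formulas -/

namespace Layout

open StackProgram.Expr

variable (S : Layout)

/-- Meaning of `Expr.adj`. -/
def Adj (n u v : ℕ) : Prop :=
  u < n ∧ v < n ∧ ∃ q < S.len, q = min u S.len * (n + 1) + v ∧ S.letter q = 1

/-- Meaning of `Expr.setPos`. -/
def setPos (n i : ℕ) : ℕ := min n S.len * (n + 1) + 1 + min i S.len * (n + 1)

/-- Meaning of `Expr.mem`. -/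
def Mem (n i v : ℕ) : Prop :=
  v < n ∧ ∃ q < S.len, q = S.setPos n i + v ∧ S.letter q = 1

/-- Meaning of `Expr.need`. -/
def Need (n i : ℕ) : Prop :=
  S.setPos n i < S.len ∧ ¬ ((∃ u < S.len, S.Mem n i u) ∧ ∀ u < S.len, ∀ v < S.len,
    S.Mem n i u → S.Mem n i v →
    u = v ∨ S.Adj n u v ∨ ∃ w < S.len, S.Mem n i w ∧ S.Adj n u w ∧ S.Adj n v w)

/-- Meaning of `Expr.cand`. -/
def Cand (n i v : ℕ) : Prop :=
  v < n ∧ (∀ j < S.len, ¬ S.Mem n j v) ∧ ∀ u < S.len, S.Mem n i u → S.Adj n u v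

/-- Meaning of `Expr.unserved`. -/
def Unserved (n i : ℕ) : Prop := S.Need n i ∧ ∀ v < S.len, v < n → S.owner v ≠ i + 1

/-- Meaning of `Expr.active`. -/
def Active (n i : ℕ) : Prop := S.Unserved n i ∧ ∀ j < S.len, j < i → ¬ S.Unserved n j

/-- Meaning of `Expr.best`. -/
def Best (n i v : ℕ) : Prop :=
  S.Cand n i v ∧ ∀ u < S.len, S.Cand n i u →
    S.price v < S.price u ∨ S.price v = S.price u ∧ v ≤ u

/-- Meaning of `Expr.buys`. -/
def Buys (n i v : ℕ) : Prop := S.Active n i ∧ S.Best n i v ∧ S.price v ≤ n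

variable {n i u v d : ℕ} {e : ℕ → ℕ}

/-- Expressions have no product, so `e n + 1` is added once for each cell numbered below `e u`; the
number of cells caps the factor. -/
theorem ev_row (hn : n < d) (hu : u < d) :
    S.ev (row n u d) d e = min (e u) S.len * (e n + 1) := by
  classical
  rw [row, ev_sum]
  simp (disch := omega) only [ev_ite, holds_lt, ev_var, ev_add, ev_const, cell_zero,
    Function.update_self, Function.update_of_ne]
  rw [← Finset.sum_filter, Finset.sum_const, smul_eq_mul]
  congr 1
  have : Finset.filter (fun j => j < e u) (Finset.range S.len) = Finset.range (min (e u) S.len) := by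
    ext j
    simp [and_comm]
  rw [this, Finset.card_range]

theorem holds_adj (hn : n < d) (hu : u < d) (hv : v < d) :
    S.Holds (adj n u v d) d e ↔ S.Adj (e n) (e u) (e v) := by
  simp (disch := omega) only [adj, Adj, holds_conj, holds_lt, holds_eq, holds_sum, ev_var, ev_add,
    ev_const, ev_row, cell_zero, cell_one, Function.update_self, Function.update_of_ne]

theorem ev_setPos (hn : n < d) (hi : i < d) :
    S.ev (Expr.setPos n i d) d e = S.setPos (e n) (e i) := by
  simp (disch := omega) only [Expr.setPos, setPos, ev_add, ev_const, ev_row]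

theorem holds_mem (hn : n < d) (hi : i < d) (hv : v < d) :
    S.Holds (mem n i v d) d e ↔ S.Mem (e n) (e i) (e v) := by
  simp (disch := omega) only [mem, Mem, holds_conj, holds_lt, holds_eq, holds_sum, ev_var, ev_add,
    ev_const, ev_setPos, cell_zero, cell_one, Function.update_self, Function.update_of_ne]

theorem holds_need (hn : n < d) (hi : i < d) :
    S.Holds (need n i d) d e ↔ S.Need (e n) (e i) := by
  simp (disch := omega) only [need, Need, holds_conj, holds_disj, holds_neg, holds_imp, holds_all,
    holds_eq, holds_sum, holds_adj, holds_mem, ev_var, ev_setPos, cell_zero, Function.update_self,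
    Function.update_of_ne, exists_eq_right]

theorem holds_cand (hn : n < d) (hi : i < d) (hv : v < d) :
    S.Holds (cand n i v d) d e ↔ S.Cand (e n) (e i) (e v) := by
  simp (disch := omega) only [cand, Cand, holds_conj, holds_neg, holds_imp, holds_all, holds_lt,
    holds_adj, holds_mem, ev_var, cell_zero, Function.update_self, Function.update_of_ne]

theorem holds_unserved (hn : n < d) (hi : i < d) :
    S.Holds (unserved n i d) d e ↔ S.Unserved (e n) (e i) := by
  simp (disch := omega) only [unserved, Unserved, holds_conj, holds_neg, holds_imp, holds_all,
    holds_lt, holds_eq, holds_need, ev_var, ev_add, ev_const, cell_zero, cell_three,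
    Function.update_self, Function.update_of_ne, ne_eq]

theorem holds_active (hn : n < d) (hi : i < d) :
    S.Holds (active n i d) d e ↔ S.Active (e n) (e i) := by
  simp (disch := omega) only [active, Active, holds_conj, holds_neg, holds_imp, holds_all,
    holds_lt, holds_unserved, ev_var, cell_zero, Function.update_self, Function.update_of_ne]

theorem holds_best (hn : n < d) (hi : i < d) (hv : v < d) :
    S.Holds (best n i v d) d e ↔ S.Best (e n) (e i) (e v) := by
  simp (disch := omega) only [best, Best, holds_conj, holds_disj, holds_neg, holds_imp, holds_all,
    holds_lt, holds_eq, holds_cand, ev_var, cell_zero, cell_two, Function.update_self,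
    Function.update_of_ne, not_lt]

theorem holds_buys (hn : n < d) (hi : i < d) (hv : v < d) :
    S.Holds (buys n i v d) d e ↔ S.Buys (e n) (e i) (e v) := by
  simp (disch := omega) only [buys, Buys, holds_conj, holds_neg, holds_lt, holds_active,
    holds_best, ev_var, cell_zero, cell_two, not_lt]

/-- The first separator is at position `n`. -/
def IsFirst (n : ℕ) : Prop := n < S.len ∧ S.letter n = 2 ∧ ∀ q < n, S.letter q ≠ 2

/-- Exactly one cell passes the guard, so the sum has a single term and acts as a binding. This is
how the number of vertices is read off the input. -/
theorem ev_bindFirst {N : ℕ} (hN : S.IsFirst N) (a : Expr) :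
    S.ev (bindFirst d a) d e = S.ev a (d + 1) (Function.update e d N) := by
  classical
  rw [bindFirst, ev_sum, Finset.sum_eq_single N]
  · rw [ev_ite, if_pos]
    simp (disch := omega) only [holds_conj, holds_neg, holds_imp, holds_all, holds_lt, holds_eq,
      ev_var, ev_const, cell_zero, cell_one, Function.update_self, Function.update_of_ne]
    exact ⟨hN.2.1, fun j _ hj => hN.2.2 j hj⟩
  · intro j _ hj
    rw [ev_ite, if_neg, ev_const]
    simp (disch := omega) only [holds_conj, holds_neg, holds_imp, holds_all, holds_lt, holds_eq,
      ev_var, ev_const, cell_zero, cell_one, Function.update_self, Function.update_of_ne]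
    rintro ⟨h1, h2⟩
    rcases lt_or_gt_of_ne hj with h | h
    · exact hN.2.2 j h h1
    · exact h2 N hN.1 h hN.2.1
  · intro h
    exact absurd (Finset.mem_range.2 hN.1) h

open Classical in
theorem ev_newPrice {N : ℕ} (hN : S.IsFirst N) :
    S.ev newPrice 1 (fun _ => v) =
      if ∃ i < S.len, S.Buys N i v then S.price v + 1 else S.price v := by
  rw [newPrice, ev_bindFirst S hN, ev_ite]
  simp (disch := omega) only [holds_sum, holds_buys, ev_add, ev_var, ev_const, cell_two,
    Function.update_self, Function.update_of_ne]

open Classical in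
theorem ev_newOwner {N : ℕ} (hN : S.IsFirst N) :
    S.ev newOwner 1 (fun _ => v) = if ∃ i < S.len, S.Buys N i v then
      ∑ i ∈ Finset.range S.len, (if S.Buys N i v then i + 1 else 0) else S.owner v := by
  rw [newOwner, ev_bindFirst S hN, ev_ite, ev_sum]
  simp (disch := omega) only [holds_sum, holds_buys, ev_add, ev_var, ev_const, cell_three, ev_ite,
    cell_zero, Function.update_self, Function.update_of_ne]

theorem holds_allServed {N : ℕ} (hN : S.IsFirst N) :
    S.Holds allServed 0 e ↔
      ∀ i < S.len, S.Need N i → ∃ v < S.len, v < N ∧ S.owner v = i + 1 := by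
  rw [allServed, Holds, ev_bindFirst S hN, ← Holds]
  simp (disch := omega) only [holds_all, holds_imp, holds_need, holds_sum, holds_conj, holds_lt,
    holds_eq, ev_add, ev_var, ev_const, cell_three, cell_zero, Function.update_self,
    Function.update_of_ne]

/-! ### Rounds of the auction as store updates -/

/-- The layout after one round of the auction. -/
def next : Layout where
  len := S.len
  letter := S.letter
  price v := S.ev newPrice 1 fun _ => v
  owner v := S.ev newOwner 1 fun _ => v

theorem updateStore_store : updateStore roundUpdate S.store = S.next.store := by
  simp only [updateStore, store, next, List.map_reverse, List.map_map]
  congr 2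
  funext j f
  fin_cases f <;> rfl

/-- The layout after `t` rounds. -/
def after : ℕ → Layout
  | 0 => S
  | t + 1 => (after t).next

theorem iterate_updateStore_store (t : ℕ) :
    (updateStore roundUpdate)^[t] S.store = (S.after t).store := by
  induction t with
  | zero => rfl
  | succ t ih => rw [Function.iterate_succ_apply', ih, updateStore_store, after]

@[simp] theorem len_after (t : ℕ) : (S.after t).len = S.len := by
  induction t with
  | zero => rfl
  | succ t ih => exact ih

@[simp] theorem letter_after (t : ℕ) : (S.after t).letter = S.letter := by
  induction t with
  | zero => rfl
  | succ t ih => exact ih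

end Layout

end StackProgram

open StackProgram

namespace DCSInstance

/-! ### Positions in the input string -/

theorem getElem?_flatten_of_length {α : Type*} {N : ℕ} (L : List (List α))
    (h : ∀ l ∈ L, l.length = N) (u v : ℕ) (hv : v < N) :
    L.flatten[u * N + v]? = L[u]?.bind fun l => l[v]? := by
  induction L generalizing u with
  | nil => simp
  | cons l L ih =>
    have hl := h l (by simp)
    rw [List.flatten_cons]
    cases u with
    | zero =>
      rw [List.getElem?_append_left (by omega)]
      simp
    | succ u =>
      rw [Nat.succ_mul, List.getElem?_append_right (by omega)]
      rw [show u * N + N + v - l.length = u * N + v by omega,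
        ih (fun x hx => h x (by simp [hx]))]
      simp

theorem length_flatten_of_length {α : Type*} {N : ℕ} (L : List (List α))
    (h : ∀ l ∈ L, l.length = N) : L.flatten.length = L.length * N := by
  induction L with
  | nil => simp
  | cons l L ih =>
    rw [List.flatten_cons, List.length_append, h l (by simp), ih fun x hx => h x (by simp [hx]),
      List.length_cons, Nat.succ_mul, Nat.add_comm]

@[simp] theorem length_encodeRow {n : ℕ} (p : Fin n → Prop) : (encodeRow p).length = n + 1 := by
  simp [encodeRow]

theorem encodeRow_getElem? {n : ℕ} (p : Fin n → Prop) (v : Fin n) :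
    ∃ b : Bool, (b = true ↔ p v) ∧ (encodeRow p)[(v : ℕ)]? = some (some b) := by
  classical
  refine ⟨decide (p v), decide_eq_true_iff, ?_⟩
  rw [encodeRow, List.getElem?_append_left (by simp)]
  simp

theorem encodeRow_getElem?_self {n : ℕ} (p : Fin n → Prop) : (encodeRow p)[n]? = some none := by
  rw [encodeRow, List.getElem?_append_right (by simp)]
  simp

variable (I : DCSInstance)

/-- This exceeds `n * (n + 1)`, so one round per letter outlasts the auction; it also determines `k`
once `n` is known. -/
theorem length_encode : I.encode.length = I.n * (I.n + 1) + 1 + I.k * (I.n + 1) := by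
  rw [encode, List.length_append, List.length_append,
    length_flatten_of_length (N := I.n + 1) _ (by simp +contextual [List.mem_ofFn]),
    length_flatten_of_length (N := I.n + 1) _ (by simp +contextual [List.mem_ofFn])]
  simp

theorem encode_getElem?_adj (u v : ℕ) (hu : u < I.n) (hv : v < I.n + 1) :
    I.encode[u * (I.n + 1) + v]? = (encodeRow fun x => I.G.Adj ⟨u, hu⟩ x)[v]? := by
  have hlen : ∀ l ∈ List.ofFn fun u => encodeRow fun v => I.G.Adj u v, l.length = I.n + 1 := by
    simp +contextual [List.mem_ofFn]
  have hlt : u * (I.n + 1) + v < I.n * (I.n + 1) := by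
    have := Nat.mul_le_mul_right (I.n + 1) (Nat.succ_le_of_lt hu)
    rw [Nat.succ_mul] at this
    omega
  rw [encode, List.append_assoc, List.getElem?_append_left
    (by rw [length_flatten_of_length _ hlen]; simpa using hlt),
    getElem?_flatten_of_length _ hlen _ _ hv]
  simp [hu]

theorem encode_getElem?_self : I.encode[I.n * (I.n + 1)]? = some none := by
  have hlen : ∀ l ∈ List.ofFn fun u => encodeRow fun v => I.G.Adj u v, l.length = I.n + 1 := by
    simp +contextual [List.mem_ofFn]
  have := length_flatten_of_length _ hlen
  rw [List.length_ofFn] at this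
  rw [encode, List.append_assoc, List.getElem?_append_right this.le, this]
  simp

theorem encode_getElem?_mem (i v : ℕ) (hi : i < I.k) (hv : v < I.n + 1) :
    I.encode[I.n * (I.n + 1) + 1 + i * (I.n + 1) + v]? =
      (encodeRow fun x => x ∈ I.Z ⟨i, hi⟩)[v]? := by
  have hlen : ∀ l ∈ List.ofFn fun u => encodeRow fun v => I.G.Adj u v, l.length = I.n + 1 := by
    simp +contextual [List.mem_ofFn]
  have hlen' : ∀ l ∈ List.ofFn fun i => encodeRow fun v => v ∈ I.Z i, l.length = I.n + 1 := by
    simp +contextual [List.mem_ofFn]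
  have h := length_flatten_of_length _ hlen
  rw [List.length_ofFn] at h
  rw [encode, List.getElem?_append_right (by rw [List.length_append, h]; simp; omega),
    List.length_append, h, List.length_singleton,
    show I.n * (I.n + 1) + 1 + i * (I.n + 1) + v - (I.n * (I.n + 1) + 1) = i * (I.n + 1) + v by
      omega, getElem?_flatten_of_length _ hlen' _ _ hv]
  simp [hi]

/-- The number of the letter at a position of the input string. -/
noncomputable def letter (q : ℕ) : ℕ := letterNum (I.encode.getD q none)

theorem letter_eq {q : ℕ} {a : Option Bool} (h : I.encode[q]? = some a) :
    I.letter q = letterNum a := by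
  rw [letter, List.getD_eq_getElem?_getD, h, Option.getD_some]

theorem letterNum_eq_one {n : ℕ} (p : Fin n → Prop) (v : Fin n) {a : Option Bool}
    (h : (encodeRow p)[(v : ℕ)]? = some a) : (letterNum a = 1 ↔ p v) ∧ letterNum a ≠ 2 := by
  obtain ⟨b, hb, h'⟩ := encodeRow_getElem? p v
  rw [h] at h'
  obtain rfl := Option.some_injective _ h'
  rw [← hb]
  cases b <;> simp [letterNum]

theorem letter_adj {u v : ℕ} (hu : u < I.n) (hv : v < I.n) :
    I.letter (u * (I.n + 1) + v) = 1 ↔ I.AdjN u v := by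
  obtain ⟨b, hb, h⟩ := encodeRow_getElem? (fun x => I.G.Adj ⟨u, hu⟩ x) ⟨v, hv⟩
  rw [I.letter_eq ((I.encode_getElem?_adj u v hu (by omega)).trans h)]
  rw [(letterNum_eq_one _ _ h).1]
  exact ⟨fun h => ⟨hu, hv, h⟩, fun ⟨_, _, h⟩ => h⟩

theorem letter_mem {i v : ℕ} (hi : i < I.k) (hv : v < I.n) :
    I.letter (I.n * (I.n + 1) + 1 + i * (I.n + 1) + v) = 1 ↔ I.MemN i v := by
  obtain ⟨b, hb, h⟩ := encodeRow_getElem? (fun x => x ∈ I.Z ⟨i, hi⟩) ⟨v, hv⟩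
  rw [I.letter_eq ((I.encode_getElem?_mem i v hi (by omega)).trans h)]
  rw [(letterNum_eq_one _ _ h).1]
  exact ⟨fun h => ⟨hi, hv, h⟩, fun ⟨_, _, h⟩ => h⟩

theorem letter_self : I.letter I.n = 2 := by
  -- Without vertices the matrix is empty and the first separator is the one after it; otherwise it
  -- closes the first row.
  rcases Nat.eq_zero_or_pos I.n with h | h
  · have := I.encode_getElem?_self
    rw [h, Nat.zero_mul] at this
    rw [h, I.letter_eq this]
    rfl
  · have := I.encode_getElem?_adj 0 I.n h (by omega)
    rw [encodeRow_getElem?_self, Nat.zero_mul, Nat.zero_add] at this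
    rw [I.letter_eq this]
    rfl

theorem letter_ne_two {q : ℕ} (hq : q < I.n) : I.letter q ≠ 2 := by
  have h0 := I.encode_getElem?_adj 0 q (by omega) (by omega)
  obtain ⟨b, hb, h⟩ := encodeRow_getElem? (fun x => I.G.Adj ⟨0, by omega⟩ x) ⟨q, hq⟩
  rw [Nat.zero_mul, Nat.zero_add] at h0
  rw [I.letter_eq (h0.trans h)]
  exact (letterNum_eq_one _ _ h).2

theorem n_lt_length : I.n < I.encode.length := by
  rw [length_encode, Nat.mul_succ]
  omega

theorem lt_length_of_lt {i : ℕ} (hi : i < I.k) : i < I.encode.length := by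
  rw [length_encode, Nat.mul_succ I.k]
  omega

/-! ### The auction on a layout of an instance -/

/-- The layout codes the instance. -/
structure Codes (S : Layout) : Prop where
  len : S.len = I.encode.length
  letter : S.letter = I.letter

variable {I} {S : Layout}

theorem Codes.isFirst (h : I.Codes S) : S.IsFirst I.n := by
  refine ⟨h.len ▸ I.n_lt_length, ?_, fun q hq => ?_⟩
  · rw [h.letter, letter_self]
  · rw [h.letter]
    exact I.letter_ne_two hq

theorem Codes.adj_iff (h : I.Codes S) {u v : ℕ} : S.Adj I.n u v ↔ I.AdjN u v := by
  constructor
  · rintro ⟨hu, hv, q, -, rfl, hq⟩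
    have := I.n_lt_length
    rw [h.letter, h.len, min_eq_left (by omega), I.letter_adj hu hv] at hq
    exact hq
  · intro ha
    obtain ⟨hu, hv, -⟩ := id ha
    have hq := (I.letter_adj hu hv).2 ha
    have hlt : u * (I.n + 1) + v < S.len := by
      have := Nat.mul_le_mul_right (I.n + 1) (Nat.succ_le_of_lt hu)
      rw [Nat.succ_mul] at this
      rw [h.len, length_encode]
      omega
    have := I.n_lt_length
    exact ⟨hu, hv, _, hlt, by rw [h.len, min_eq_left (by omega)], by rw [h.letter, hq]⟩

theorem Codes.setPos_eq (h : I.Codes S) {i : ℕ} (hi : i < I.k) :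
    S.setPos I.n i = I.n * (I.n + 1) + 1 + i * (I.n + 1) := by
  have h1 := I.n_lt_length
  have h2 := I.lt_length_of_lt hi
  rw [Layout.setPos, h.len, min_eq_left h1.le, min_eq_left h2.le]

/-- The blocks of the terminal sets fill the string up to its end. The cap in `setPos` does no harm
since `k` is at most the length. -/
theorem Codes.setPos_lt_iff (h : I.Codes S) {i : ℕ} : S.setPos I.n i < S.len ↔ i < I.k := by
  constructor
  · intro hlt
    by_contra hi
    have h1 := I.n_lt_length
    have h2 : I.k ≤ S.len := by rw [h.len, length_encode, Nat.mul_succ I.k]; omega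
    have h3 := Nat.mul_le_mul_right (I.n + 1) (le_min (not_lt.1 hi) h2)
    rw [Layout.setPos, min_eq_left (by rw [h.len]; exact h1.le)] at hlt
    have h4 := h.len
    rw [length_encode] at h4
    omega
  · intro hi
    have := Nat.mul_le_mul_right (I.n + 1) (Nat.succ_le_of_lt hi)
    rw [Nat.succ_mul] at this
    rw [h.setPos_eq hi, h.len, length_encode]
    omega

/-- The condition `v < n` keeps the position inside one block, and a position inside the string
forces `i < k`. -/
theorem Codes.mem_iff (h : I.Codes S) {i v : ℕ} : S.Mem I.n i v ↔ I.MemN i v := by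
  constructor
  · rintro ⟨hv, q, hql, rfl, hq⟩
    have hi : i < I.k := h.setPos_lt_iff.1 (by omega)
    rw [h.letter, h.setPos_eq hi, I.letter_mem hi hv] at hq
    exact hq
  · intro hm
    obtain ⟨hi, hv, -⟩ := id hm
    have hq := (I.letter_mem hi hv).2 hm
    refine ⟨hv, _, ?_, rfl, by rw [h.letter, h.setPos_eq hi, hq]⟩
    have := Nat.mul_le_mul_right (I.n + 1) (Nat.succ_le_of_lt hi)
    rw [Nat.succ_mul] at this
    rw [h.setPos_eq hi, h.len, length_encode]
    omega

/-- Quantifiers in formulas range over cell numbers only; this shows that no relevant set or vertex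
is missed. -/
theorem Codes.lt_len_of_memN (h : I.Codes S) {i v : ℕ} (hm : I.MemN i v) :
    i < S.len ∧ v < S.len := by
  obtain ⟨hi, hv, -⟩ := hm
  rw [h.len]
  exact ⟨I.lt_length_of_lt hi, hv.trans I.n_lt_length⟩

theorem Codes.need_iff (h : I.Codes S) {i : ℕ} : S.Need I.n i ↔ I.NeedN i := by
  simp only [Layout.Need, NeedN, h.setPos_lt_iff, h.mem_iff, h.adj_iff]
  refine and_congr_right fun _ => not_congr (and_congr ?_ ?_)
  · exact ⟨fun ⟨u, _, hu⟩ => ⟨u, hu⟩, fun ⟨u, hu⟩ => ⟨u, (h.lt_len_of_memN hu).2, hu⟩⟩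
  · constructor
    · intro H u v hu hv
      rcases H u (h.lt_len_of_memN hu).2 v (h.lt_len_of_memN hv).2 hu hv with
        h1 | h1 | ⟨w, _, hw⟩
      exacts [Or.inl h1, Or.inr (Or.inl h1), Or.inr (Or.inr ⟨w, hw⟩)]
    · intro H u _ v _ hu hv
      rcases H u v hu hv with h1 | h1 | ⟨w, hw⟩
      exacts [Or.inl h1, Or.inr (Or.inl h1), Or.inr (Or.inr ⟨w, (h.lt_len_of_memN hw.1).2, hw⟩)]

theorem Codes.cand_iff (h : I.Codes S) {i v : ℕ} : S.Cand I.n i v ↔ I.CandN i v := by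
  simp only [Layout.Cand, CandN, h.mem_iff, h.adj_iff]
  refine and_congr_right fun _ => and_congr ?_ ?_
  · exact ⟨fun H j hj => H j (h.lt_len_of_memN hj).1 hj, fun H j _ => H j⟩
  · exact ⟨fun H u hu => H u (h.lt_len_of_memN hu).2 hu, fun H u _ => H u⟩

theorem Codes.lt_len_of_needN (h : I.Codes S) {i : ℕ} (hn : I.NeedN i) : i < S.len := by
  rw [h.len]
  exact I.lt_length_of_lt hn.1

theorem Codes.lt_len_of_lt (h : I.Codes S) {v : ℕ} (hv : v < I.n) : v < S.len := by
  rw [h.len]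
  exact hv.trans I.n_lt_length

theorem Codes.unserved_iff (h : I.Codes S) {i : ℕ} :
    S.Unserved I.n i ↔ Auction.Unserved I.n I.NeedN S.owner i := by
  rw [Layout.Unserved, Auction.Unserved, h.need_iff]
  exact and_congr_right fun _ => ⟨fun H v hv => H v (h.lt_len_of_lt hv) hv, fun H v _ => H v⟩

theorem Codes.active_iff (h : I.Codes S) {i : ℕ} :
    S.Active I.n i ↔ Auction.Active I.n I.NeedN S.owner i := by
  simp only [Layout.Active, Auction.Active, h.unserved_iff]
  exact and_congr_right fun _ =>
    ⟨fun H j hj hu => H j (h.lt_len_of_needN hu.1) hj hu, fun H j _ => H j⟩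

theorem Codes.best_iff (h : I.Codes S) {i v : ℕ} :
    S.Best I.n i v ↔ Auction.Best I.CandN S.price i v := by
  simp only [Layout.Best, Auction.Best, h.cand_iff]
  exact and_congr_right fun _ =>
    ⟨fun H u hu => H u (h.lt_len_of_lt hu.1) hu, fun H u _ => H u⟩

theorem Codes.buys_iff (h : I.Codes S) {i v : ℕ} :
    S.Buys I.n i v ↔ Auction.Buys I.n I.NeedN I.CandN S.price S.owner i v := by
  rw [Layout.Buys, Auction.Buys, h.active_iff, h.best_iff]

/-- The buyer is unique, so the sum over buyers in `newOwner` has one nonzero term, the successor of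
the buyer's number. -/
theorem Codes.round (h : I.Codes S) :
    Auction.Round I.n I.NeedN I.CandN S.price S.owner S.next.price S.next.owner := by
  classical
  constructor
  · intro i v hb
    have hi := h.lt_len_of_needN hb.1.1.1
    have hex : ∃ i < S.len, S.Buys I.n i v := ⟨i, hi, h.buys_iff.2 hb⟩
    simp only [Layout.next]
    rw [S.ev_newPrice h.isFirst, S.ev_newOwner h.isFirst, if_pos hex, if_pos hex,
      Finset.sum_eq_single i]
    · rw [if_pos (h.buys_iff.2 hb)]
      exact ⟨rfl, rfl⟩
    · intro j _ hj
      exact if_neg fun hb' => hj ((h.buys_iff.1 hb').1.unique hb.1)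
    · intro hi'
      exact absurd (Finset.mem_range.2 hi) hi'
  · intro v hv
    have hex : ¬ ∃ i < S.len, S.Buys I.n i v := fun ⟨i, _, hb⟩ => hv i (h.buys_iff.1 hb)
    simp only [Layout.next]
    rw [S.ev_newPrice h.isFirst, S.ev_newOwner h.isFirst, if_neg hex, if_neg hex]
    exact ⟨rfl, rfl⟩

variable (I)

/-- The initial layout of an instance. -/
noncomputable def layout : Layout where
  len := I.encode.length
  letter := I.letter
  price _ := 0
  owner _ := 0

theorem initStore_encode : initStore I.encode = I.layout.store := by
  rw [initStore, Layout.store]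
  congr 1
  refine List.ext_getElem (by simp [layout]) fun j h1 h2 => ?_
  have hj : j < I.encode.length := by simpa using h1
  simp [Layout.cell, layout, letter, initCell, hj]

theorem codes_after (t : ℕ) : I.Codes (I.layout.after t) :=
  ⟨Layout.len_after _ t, Layout.letter_after _ t⟩

theorem inv_after (t : ℕ) : Auction.Inv I.n I.NeedN I.CandN (I.layout.after t).price
    (I.layout.after t).owner :=
  Auction.inv_of_rounds (P := fun t => (I.layout.after t).price)
    (O := fun t => (I.layout.after t).owner) (fun _ _ h => h.1) (fun _ => rfl) (fun _ => rfl)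
    (fun t => (I.codes_after t).round) t

/-- The auction invariant bounds prices by `n + 1` and owners by `k`, both at most the length. The
extra two accommodates the letter code `2`. -/
theorem storeLe_after (t : ℕ) :
    Expr.StoreLe (I.encode.length + 2) (I.layout.after t).store := by
  intro x hx f
  simp only [Layout.store, List.mem_reverse, List.mem_map, List.mem_range,
    (I.codes_after t).len] at hx
  obtain ⟨j, hj, rfl⟩ := hx
  have hinv := I.inv_after t
  have hn := I.n_lt_length
  fin_cases f
  · change j ≤ _
    omega
  · change (I.layout.after t).letter j ≤ _
    rw [(I.codes_after t).letter, letter]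
    generalize I.encode.getD j none = a
    rcases a with _ | _ | _ <;> simp [letterNum]
  · change (I.layout.after t).price j ≤ _
    have := hinv.le j
    omega
  · change (I.layout.after t).owner j ≤ _
    rcases ho : (I.layout.after t).owner j with _ | i
    · omega
    · have := I.lt_length_of_lt (hinv.valid j i ho).1.1
      omega

theorem holds_allServed_iff (hI : I.IsP4Free) (e : ℕ → ℕ) :
    (I.layout.after I.encode.length).Holds Expr.allServed 0 e ↔ I.IsYes := by
  have hc := I.codes_after I.encode.length
  rw [Layout.holds_allServed _ hc.isFirst, I.isYes_iff hI,
    ← Auction.served_iff (P := fun t => (I.layout.after t).price)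
      (O := fun t => (I.layout.after t).owner) (T := I.encode.length) (fun _ _ h => h.1)
      (fun _ => rfl) (fun _ => rfl) (fun t => (I.codes_after t).round)
      (by rw [length_encode]; omega)]
  simp only [hc.need_iff]
  constructor
  · intro h i hi
    obtain ⟨v, -, hv⟩ := h i (hc.lt_len_of_needN hi) hi
    exact ⟨v, hv⟩
  · intro h i _ hi
    obtain ⟨v, hv, ho⟩ := h i hi
    exact ⟨v, hc.lt_len_of_lt hv, hv, ho⟩

end DCSInstance

theorem mainTheorem6 :
    PolyTimeSolvableOn DCSInstance.encode DCSInstance.IsYes DCSInstance.IsP4Free := by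
  refine polyTimeSolvableOn_of_updateStore _ _ _ Expr.roundUpdate Expr.allServed
    (fun I _ t => ?_) fun I hI => ?_
  · rw [I.initStore_encode, Layout.iterate_updateStore_store]
    exact I.storeLe_after t
  · rw [I.initStore_encode, Layout.iterate_updateStore_store]
    exact ⟨_, I.holds_allServed_iff hI fun _ => 0⟩
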